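/- Let $K\ge 3$ and $\theta,p>0$. For $N\ge 2$ let $(\eta_t)_{t\ge 0}$ be the continuous-time Markov chain of $N$ particles on $\mathbb{Z}/K\mathbb{Z}$ with state space $\mathcal{E}_{K,N}=\{\eta:\mathbb{Z}/K\mathbb{Z}\to\mathbb{N},\ \sum_k\eta(k)=N\}$ and generator $$\mathcal{L}_{K,N}f(\eta)=\sum_{i,j\in\mathbb{Z}/K\mathbb{Z}}\eta(i)\,[f(\eta-e_i+e_j)-f(\eta)]\Big(\mathbf 1_{\{j=i+1\}}+\theta\,\mathbf 1_{\{j=i-1\}}+p\,\frac{\eta(j)}{N-1}\Big),$$ where $e_i$ is the $i$-th canonical vector. Let $\nu_N$ be its stationary distribution, and write $\operatorname{Var}_\eta,\mathbb{E}_\eta$ (resp. $\operatorname{Var}_{\nu_N}$) for the chain started from $\eta$ (resp. from $\nu_N$). Put $m(\eta)=\frac1N\sum_k\eta(k)\delta_k$ and let $\|\cdot\|_2$ be the Euclidean norm on $\mathbb{R}^K$. Let $(X_t)_{t\ge0}$ be the random walk on $\mathbb{Z}/K\mathbb{Z}$ with generator $\mathcal Hf(x)=f(x+1)-f(x)+\theta[f(x-1)-f(x)]$,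 let $\tau_p$ be an exponential random variable with mean $1/p$ independent of $(X_t)_{t\ge 0}$, and let $\mathcal{L}_\mu(X_t\mid t\le\tau_p)$ be the conditional law of $X_t$ given $t\le\tau_p$ when $X_0$ has law $\mu$. Define $$\alpha_K=\begin{cases}2(1+\theta)&K\text{ even},\\ 2(1+\theta)\cos^2\frac{\pi}{2K}&K\text{ odd},\end{cases}\qquad \rho_K=2(1+\theta)\sin^2\frac{\pi}{K},\qquad p_N=\frac{2p}{N-1},$$ $$C_{K,N}=\frac2N\Big(1+\theta+\frac{p}{N-1}+\frac{pN(K+1)\sqrt{K-1}}{K\sqrt K(N-1)}\Big),\qquad D_K=2\Big(1+\theta+\frac{p(K+1)\sqrt{K-1}}{K\sqrt K}\Big),$$ $$E_K=\frac{K-1}{K^2}+\frac{K^2-1}{6K^2(1+\theta)},\qquad E'_K=\frac{K-1}{K^2}+\frac{p(K^2-1)}{6K^2(1+\theta)}.$$ (a) For all $N\ge2$ and $t\ge0$, $$\max_{\eta\in\mathcal{E}_{K,N},\ k\in\mathbb{Z}/K\mathbb{Z}}\left|\operatorname{Var}_\eta\Big[\frac{\eta_t(k)}N\Big]-\operatorname{Var}_{\nu_N}\Big[\frac{\eta_t(k)}N\Big]\right|\le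 C_{K,N}\,\frac{e^{-p_Nt}-e^{-\rho_Kt}}{\rho_K-p_N}+e^{-p_Nt}\operatorname{Var}_{\nu_N}\Big[\frac{\eta(0)}N\Big],$$ where the quotient is read as its limit $t\,e^{-p_Nt}$ if $\rho_K=p_N$. (b) There is a sequence $r_N=o(1/\sqrt N)$, depending only on $K,\theta,p$, such that for all $N\ge2$, $\eta\in\mathcal{E}_{K,N}$, all probability measures $\mu$ on $\mathbb{Z}/K\mathbb{Z}$ and all $t\ge0$, $$e^{-\alpha_Kt}\|m(\eta)-\mu\|_2\le\mathbb{E}_\eta\big[\|m(\eta_t)-\mathcal{L}_\mu(X_t\mid t\le\tau_p)\|_2\big]\le\sqrt{\frac KN}\Big(D_K\frac{1-e^{-\rho_Kt}}{\rho_K}+E_K\Big)^{1/2}+e^{-\rho_Kt}\|m(\eta)-\mu\|_2+r_N,$$ and the same upper bound holds with $E_K$ replaced by $E'_K$. -/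

import Mathlib

open MeasureTheory ProbabilityTheory Filter Asymptotics
open scoped NNReal ENNReal

noncomputable section

namespace FlemingViot

/-! ### Continuous-time Markov chains on a finite state space -/

section Chains

variable {S : Type*} [Fintype S] [DecidableEq S]

/-- The rate matrix of an operator `G` acting on real functions on a finite set:
`G f x = ∑ y, rateMatrix G x y * f y` for linear `G`. -/
def rateMatrix (G : (S → ℝ) → S → ℝ) : Matrix S S ℝ :=
  Matrix.of fun x y => G (Pi.single y 1) x

/-- The transition matrix `P_t = exp (t A)` of the chain with rate matrix `A`. -/
def transition (A : Matrix S S ℝ) (t : ℝ) : Matrix S S ℝ :=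
  NormedSpace.exp (t • A)

/-- `X` is, under `P`, a continuous-time Markov chain with infinitesimal generator matrix `A` and
initial distribution `μ`: for all times `0 ≤ t₀ ≤ t₁ ≤ … ≤ tₙ`, the probability that
`X_{t₀} = x₀, …, X_{tₙ} = xₙ` is `(μ P_{t₀})(x₀) P_{t₁ - t₀}(x₀, x₁) ⋯ P_{tₙ - tₙ₋₁}(xₙ₋₁, xₙ)`. -/
structure IsMarkovChain [MeasurableSpace S] (A : Matrix S S ℝ) (μ : Measure S)
    {Ω : Type*} [MeasurableSpace Ω] (P : Measure Ω) (X : ℝ≥0 → Ω → S) : Prop where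
  measurable : ∀ t, Measurable (X t)
  fdd : ∀ (n : ℕ) (t : Fin (n + 1) → ℝ≥0), Monotone t → ∀ x : Fin (n + 1) → S,
    P.real {ω | ∀ i, X (t i) ω = x i} =
      (∑ y, μ.real {y} * transition A (t 0) y (x 0)) *
        ∏ i : Fin n,
          transition A ((t i.succ : ℝ) - t i.castSucc) (x i.castSucc) (x i.succ)

/-- `ν` is a stationary distribution of the chain with generator matrix `A`: `ν A = 0`. -/
def IsStationary [MeasurableSpace S] (A : Matrix S S ℝ) (ν : Measure S) : Prop :=
  IsProbabilityMeasure ν ∧ ∀ y, ∑ x, ν.real {x} * A x y = 0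

end Chains

/-! ### The random walk on the cycle and the `N`-particle system -/

/-- The generator of the asymmetric random walk on `ℤ/Kℤ` without killing. -/
def walkGenerator (K : ℕ) (θ : ℝ) (f : ZMod K → ℝ) (x : ZMod K) : ℝ :=
  (f (x + 1) - f x) + θ * (f (x - 1) - f x)

variable {K : ℕ} [NeZero K] {N : ℕ}

/-- The configurations of `N` particles on `ℤ/Kℤ`. -/
abbrev Config (K : ℕ) [NeZero K] (N : ℕ) : Type :=
  {η : ZMod K → ℕ // ∑ k, η k = N}

instance Config.instFinite : Finite (Config K N) := by
  refine Finite.of_injective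
    (fun (η : Config K N) (k : ZMod K) => (⟨η.1 k, ?_⟩ : Fin (N + 1))) ?_
  · have h : η.1 k ≤ ∑ k, η.1 k :=
      Finset.single_le_sum (fun _ _ => Nat.zero_le _) (Finset.mem_univ k)
    rw [η.2] at h
    omega
  · intro η ξ h
    apply Subtype.ext
    funext k
    exact congrArg Fin.val (congrFun h k)

instance Config.instFintype : Fintype (Config K N) := Fintype.ofFinite _

/-- The configuration `T_{i → j} η = η - e_i + e_j`, for `η(i) > 0`
(by convention `η` itself when `η(i) = 0`). -/
def Config.move (η : Config K N) (i j : ZMod K) : Config K N :=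
  if h : 0 < η.1 i then
    ⟨fun k => η.1 k - (if k = i then 1 else 0) + (if k = j then 1 else 0), by
      have h1 : ∑ k, (η.1 k - (if k = i then 1 else 0)) + 1 = N := by
        have h2 : ∑ k, (η.1 k - (if k = i then 1 else 0)) + ∑ k, (if k = i then 1 else 0)
            = ∑ k, η.1 k := by
          rw [← Finset.sum_add_distrib]
          refine Finset.sum_congr rfl fun k _ => ?_
          split_ifs with hk
          · subst hk; omega
          · omega
        rw [η.2] at h2
        simpa using h2
      rw [Finset.sum_add_distrib]
      simpa using h1⟩
  else η

/-- The generator of the `N`-particle process. -/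
def particleGenerator (K : ℕ) [NeZero K] (N : ℕ) (θ p : ℝ) (f : Config K N → ℝ)
    (η : Config K N) : ℝ :=
  ∑ i, ∑ j, (η.1 i : ℝ) * (f (η.move i j) - f η) *
    ((if j = i + 1 then 1 else 0) + θ * (if j = i - 1 then 1 else 0)
      + p * ((η.1 j : ℝ) / ((N : ℝ) - 1)))

/-- The empirical distribution `m(η) = N⁻¹ ∑ₖ η(k) δₖ` of a configuration. -/
def empirical (η : Config K N) : Measure (ZMod K) :=
  (N : ℝ≥0∞)⁻¹ • ∑ k, (η.1 k : ℝ≥0∞) • Measure.dirac k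

/-- The Euclidean distance `‖μ - ν‖₂` between two distributions on `ℤ/Kℤ`. -/
def dist₂ (μ ν : Measure (ZMod K)) : ℝ :=
  √(∑ k, |μ.real {k} - ν.real {k}| ^ 2)

/-! ### The constants -/

def alpha (K : ℕ) (θ : ℝ) : ℝ :=
  if Even K then 2 * (1 + θ) else 2 * (1 + θ) * Real.cos (Real.pi / (2 * K)) ^ 2

def rho (K : ℕ) (θ : ℝ) : ℝ := 2 * (1 + θ) * Real.sin (Real.pi / K) ^ 2

def pN (N : ℕ) (p : ℝ) : ℝ := 2 * p / ((N : ℝ) - 1)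

def constC (K N : ℕ) (θ p : ℝ) : ℝ :=
  2 / N * (1 + θ + p / ((N : ℝ) - 1)
    + p * N * ((K : ℝ) + 1) * √((K : ℝ) - 1) / (K * √(K : ℝ) * ((N : ℝ) - 1)))

def constD (K : ℕ) (θ p : ℝ) : ℝ :=
  2 * (1 + θ + p * ((K : ℝ) + 1) * √((K : ℝ) - 1) / (K * √(K : ℝ)))

/-- The constant `E_K`. -/
def constE (K : ℕ) (θ : ℝ) : ℝ :=
  ((K : ℝ) - 1) / (K : ℝ) ^ 2 + ((K : ℝ) ^ 2 - 1) / (6 * (K : ℝ) ^ 2 * (1 + θ))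

/-- The constant `E'_K`, which differs from `E_K` by the factor `p` in the second summand: it is
the limit of `N` times the stationary variance of the proportion of particles at a site. -/
def constE' (K : ℕ) (θ p : ℝ) : ℝ :=
  ((K : ℝ) - 1) / (K : ℝ) ^ 2 + p * ((K : ℝ) ^ 2 - 1) / (6 * (K : ℝ) ^ 2 * (1 + θ))

/-- The quotient `(e^{-a t} - e^{-b t}) / (b - a)`, extended by continuity to `a = b`. -/
def expQuotient (a b t : ℝ) : ℝ :=
  if a = b then t * Real.exp (-a * t)
  else (Real.exp (-a * t) - Real.exp (-b * t)) / (b - a)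

end FlemingViot

end

/-! The redistribution of particles is symmetric in the two sites involved, so it contributes
nothing to the generator of a linear functional `lin w`: `particleGenerator_lin` gives the walk
generator applied to `w`. The mean profile therefore evolves as the law of a single unkilled walk.
By `cond_map_real`, that law is also the conditioned law, because killing is independent of the
walk. On squares, `particleGenerator_lin_sq` adds only a carré du champ of order 1/N and a term `pN`
times the variance of `w` under the empirical measure, so second moments close as well.

For (a), the test function is transported backwards, w_s = e^{(t-s)H} 1_k. The mean of `lin (w s)`
is then constant, and its variance solves V' = source - `pN` V, where the source depends on the
initial law only through the mean profile (`hasDerivAt_lawVar`). That profile tends to uniform at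
rate `rho`, by Parseval on the cycle (`sum_sq_le_exp_rho`). The difference of variances between the
start at η and the stationary start is thus a Duhamel integral of e^{-`pN`(t-s)} e^{-`rho` s}, which
is the stated quotient. The remaining term is the stationary variance of w_0, bounded by Jensen and
the homogeneity of sites (`lawVar_stationary_le`, `lawVar_stationary_single`).

For (b), the bias, that is the mean profile minus the law of the walk, solves the adjoint walk
equation, so its Euclidean norm decays at a rate between `rho` and `alpha`. The lower bound follows
because the norm of a mean is at most the mean of the norm. For the upper bound, the fluctuation
around the mean is controlled by the total variance, and `sum_lawVar_le` bounds this directly by a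
Poincaré inequality and Grönwall. -/

namespace FlemingViot

/-! ### Fourier analysis on the cycle: sharp bounds for the Dirichlet form. -/

section Cycle

variable {K : ℕ} [NeZero K]

/-- Parseval's identity for real functions on `ℤ/Kℤ`. -/
theorem sum_normSq_dft (v : ZMod K → ℝ) :
    ∑ k, Complex.normSq (ZMod.dft (fun j => (v j : ℂ)) k) = K * ∑ j, v j ^ 2 := by
  have hconj : ∀ k, (starRingEnd ℂ) (ZMod.dft (fun j => (v j : ℂ)) k)
      = ∑ j, ZMod.stdAddChar (j * k) * (v j : ℂ) := by
    intro k
    rw [ZMod.dft_apply, map_sum]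
    refine Finset.sum_congr rfl fun j _ => ?_
    rw [smul_eq_mul, map_mul, Complex.conj_ofReal, AddChar.map_neg_eq_conj, Complex.conj_conj]
  have h : ((∑ k, Complex.normSq (ZMod.dft (fun j => (v j : ℂ)) k) : ℝ) : ℂ)
      = ((K * ∑ j, v j ^ 2 : ℝ) : ℂ) := by
    push_cast
    simp_rw [Complex.normSq_eq_conj_mul_self, hconj, Finset.sum_mul]
    rw [Finset.sum_comm, Finset.mul_sum]
    refine Finset.sum_congr rfl fun j _ => ?_
    have := congrFun (ZMod.dft_dft (fun j => (v j : ℂ))) (-j)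
    rw [ZMod.dft_apply] at this
    simp only [neg_neg, smul_eq_mul] at this
    calc _ = (v j : ℂ) * ∑ x, ZMod.stdAddChar (j * x) * ZMod.dft (fun j => (v j : ℂ)) x := by
          rw [Finset.mul_sum]
          exact Finset.sum_congr rfl fun x _ => by ring
      _ = (v j : ℂ) * (K * v j) := by
          rw [← this]
          congr 1
          exact Finset.sum_congr rfl fun x _ => by rw [mul_neg, neg_neg, mul_comm j x]
      _ = _ := by ring
  exact_mod_cast h

theorem dft_sub_shift (v : ZMod K → ℝ) (k : ZMod K) :
    ZMod.dft (fun j => ((v (j + 1) - v j : ℝ) : ℂ)) k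
      = (ZMod.stdAddChar k - 1) * ZMod.dft (fun j => (v j : ℂ)) k := by
  simp only [ZMod.dft_apply, smul_eq_mul, sub_mul, one_mul, Complex.ofReal_sub, mul_sub,
    Finset.sum_sub_distrib]
  congr 1
  rw [Finset.mul_sum, ← Equiv.sum_comp (Equiv.addRight (1 : ZMod K))
    (fun j => ZMod.stdAddChar k * (ZMod.stdAddChar (-(j * k)) * (v j : ℂ)))]
  refine Finset.sum_congr rfl fun j _ => ?_
  rw [← mul_assoc, ← AddChar.map_add_eq_mul, Equiv.coe_addRight]
  congr 2
  ring

theorem normSq_stdAddChar_sub_one (k : ZMod K) :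
    Complex.normSq (ZMod.stdAddChar k - 1) = 4 * Real.sin (Real.pi * k.val / K) ^ 2 := by
  have h : (ZMod.stdAddChar k : ℂ) = Complex.exp ((2 * (Real.pi * k.val / K) : ℝ) * Complex.I) := by
    have := ZMod.stdAddChar_coe (N := K) k.val
    rw [Int.cast_natCast, ZMod.natCast_zmod_val] at this
    rw [this]
    congr 1
    push_cast
    ring
  rw [h, Complex.exp_mul_I, ← Complex.ofReal_cos, ← Complex.ofReal_sin, Complex.normSq_apply]
  simp only [Complex.sub_re, Complex.add_re, Complex.ofReal_re, Complex.mul_re, Complex.I_re,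
    Complex.ofReal_im, Complex.I_im, Complex.one_re, Complex.sub_im, Complex.add_im, Complex.mul_im,
    Complex.one_im]
  rw [Real.cos_two_mul, Real.sin_two_mul]
  have := Real.sin_sq_add_cos_sq (Real.pi * k.val / K)
  linear_combination (4 * Real.cos (Real.pi * k.val / K) ^ 2 - 4) * this

theorem sum_sq_sub_shift (v : ZMod K → ℝ) :
    K * ∑ j, (v (j + 1) - v j) ^ 2
      = ∑ k : ZMod K, 4 * Real.sin (Real.pi * k.val / K) ^ 2
          * Complex.normSq (ZMod.dft (fun j => (v j : ℂ)) k) := by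
  rw [← sum_normSq_dft (fun j => v (j + 1) - v j)]
  refine Finset.sum_congr rfl fun k _ => ?_
  rw [dft_sub_shift, Complex.normSq_mul, normSq_stdAddChar_sub_one]

/-- The lowest nonzero frequencies are 1 and K - 1: reflecting angles beyond π/2 brings every
frequency into the range where the sine increases. -/
theorem sin_sq_pi_div_le {k : ZMod K} (hk : k ≠ 0) :
    Real.sin (Real.pi / K) ^ 2 ≤ Real.sin (Real.pi * k.val / K) ^ 2 := by
  have hKn : 0 < K := Nat.pos_of_ne_zero (NeZero.ne K)
  have hK : (0 : ℝ) < K := by exact_mod_cast hKn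
  have hv : 1 ≤ k.val := Nat.one_le_iff_ne_zero.mpr (by rwa [Ne, ZMod.val_eq_zero])
  have hv' : k.val + 1 ≤ K := ZMod.val_lt k
  have hvr : (1 : ℝ) ≤ k.val := by exact_mod_cast hv
  have hvr' : (k.val : ℝ) + 1 ≤ K := by exact_mod_cast hv'
  have hpi := Real.pi_pos
  have h0 : 0 ≤ Real.sin (Real.pi / K) := by
    apply Real.sin_nonneg_of_nonneg_of_le_pi (by positivity)
    rw [div_le_iff₀ hK]
    nlinarith
  apply pow_le_pow_left₀ h0
  have hmain : ∀ y : ℝ, Real.pi / K ≤ y → y ≤ Real.pi / 2 →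
      Real.sin (Real.pi / K) ≤ Real.sin y := by
    intro y h1 h2
    apply Real.sin_le_sin_of_le_of_le_pi_div_two _ h2 h1
    have : 0 ≤ Real.pi / K := by positivity
    linarith
  rcases le_total (Real.pi * k.val / K) (Real.pi / 2) with h | h
  · apply hmain _ _ h
    gcongr
    nlinarith
  · rw [← Real.sin_pi_sub (Real.pi * k.val / K)]
    apply hmain _ _ (by linarith)
    rw [le_sub_iff_add_le, ← add_div, div_le_iff₀ hK]
    nlinarith

/-- The Poincaré inequality on the cycle. -/
theorem poincare_cycle (v : ZMod K → ℝ) (hv : ∑ j, v j = 0) :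
    4 * Real.sin (Real.pi / K) ^ 2 * ∑ j, v j ^ 2 ≤ ∑ j, (v (j + 1) - v j) ^ 2 := by
  have hK : (0 : ℝ) < K := by exact_mod_cast Nat.pos_of_ne_zero (NeZero.ne K)
  refine le_of_mul_le_mul_left ?_ hK
  rw [sum_sq_sub_shift, mul_left_comm, ← sum_normSq_dft, Finset.mul_sum]
  refine Finset.sum_le_sum fun k _ => ?_
  rcases eq_or_ne k 0 with rfl | hk
  · rw [ZMod.dft_apply_zero, ← Complex.ofReal_sum, hv]
    simp
  · have := sin_sq_pi_div_le hk
    have h2 := Complex.normSq_nonneg (ZMod.dft (fun j => (v j : ℂ)) k)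
    gcongr

theorem sum_sq_sub_shift_le {c : ℝ}
    (hc : ∀ k : ZMod K, Real.sin (Real.pi * k.val / K) ^ 2 ≤ c) (v : ZMod K → ℝ) :
    ∑ j, (v (j + 1) - v j) ^ 2 ≤ 4 * c * ∑ j, v j ^ 2 := by
  have hK : (0 : ℝ) < K := by exact_mod_cast Nat.pos_of_ne_zero (NeZero.ne K)
  refine le_of_mul_le_mul_left ?_ hK
  rw [sum_sq_sub_shift, mul_left_comm, ← sum_normSq_dft, Finset.mul_sum]
  refine Finset.sum_le_sum fun k _ => ?_
  have := hc k
  have h2 := Complex.normSq_nonneg (ZMod.dft (fun j => (v j : ℂ)) k)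
  gcongr

/-- For odd K no angle πk/K equals π/2. The closest come from k = (K ± 1)/2, at distance π/(2K),
whence the cosine. -/
theorem sin_sq_le_cos_sq_of_odd (hodd : ¬ Even K) (k : ZMod K) :
    Real.sin (Real.pi * k.val / K) ^ 2 ≤ Real.cos (Real.pi / (2 * K)) ^ 2 := by
  have hKn : 0 < K := Nat.pos_of_ne_zero (NeZero.ne K)
  have hK : (0 : ℝ) < K := by exact_mod_cast hKn
  have hpi := Real.pi_pos
  have hlt : k.val < K := ZMod.val_lt k
  have hltr : (k.val : ℝ) < K := by exact_mod_cast hlt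
  obtain ⟨c, hc⟩ := Nat.not_even_iff_odd.mp hodd
  have h0 : 0 ≤ Real.sin (Real.pi * k.val / K) := by
    apply Real.sin_nonneg_of_nonneg_of_le_pi (by positivity)
    rw [div_le_iff₀ hK]
    gcongr
  apply pow_le_pow_left₀ h0
  rw [← Real.sin_pi_div_two_sub]
  have hmain : ∀ y : ℝ, 0 ≤ y → y ≤ Real.pi / 2 - Real.pi / (2 * K) →
      Real.sin y ≤ Real.sin (Real.pi / 2 - Real.pi / (2 * K)) := by
    intro y h1 h2
    apply Real.sin_le_sin_of_le_of_le_pi_div_two (by linarith) _ h2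
    have : 0 ≤ Real.pi / (2 * K) := by positivity
    linarith
  rcases le_or_gt (2 * k.val + 1) K with h | h
  · have hr : 2 * (k.val : ℝ) + 1 ≤ K := by exact_mod_cast h
    apply hmain _ (by positivity)
    rw [div_sub_div _ _ two_ne_zero (by positivity), div_le_div_iff₀ hK (by positivity)]
    nlinarith [mul_le_mul_of_nonneg_left hr (mul_pos hpi hK).le]
  · have h' : K + 1 ≤ 2 * k.val := by omega
    have hr : (K : ℝ) + 1 ≤ 2 * k.val := by exact_mod_cast h'
    rw [← Real.sin_pi_sub (Real.pi * k.val / K)]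
    apply hmain
    · rw [sub_nonneg, div_le_iff₀ hK]
      gcongr
    · rw [div_sub_div _ _ two_ne_zero (by positivity), sub_le_iff_le_add, div_add_div _ _
        (by positivity) hK.ne', le_div_iff₀ (by positivity)]
      nlinarith [mul_le_mul_of_nonneg_left hr (mul_pos hpi hK).le]

/-- The largest eigenvalue of the symmetrized walk on the cycle is at most `alpha K θ`. -/
theorem dirichlet_le_alpha {θ : ℝ} (hθ : 0 < θ) (v : ZMod K → ℝ) :
    (1 + θ) * ∑ j, (v (j + 1) - v j) ^ 2 ≤ 2 * alpha K θ * ∑ j, v j ^ 2 := by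
  unfold alpha
  split_ifs with h
  · have := sum_sq_sub_shift_le (K := K) (c := 1) (fun k => Real.sin_sq_le_one _) v
    calc _ ≤ (1 + θ) * (4 * 1 * ∑ j, v j ^ 2) := by gcongr
      _ = _ := by ring
  · have := sum_sq_sub_shift_le (sin_sq_le_cos_sq_of_odd h) v
    calc _ ≤ (1 + θ) * (4 * Real.cos (Real.pi / (2 * K)) ^ 2 * ∑ j, v j ^ 2) := by gcongr
      _ = _ := by ring

/-- The spectral gap of the symmetrized walk on the cycle is at least `rho K θ`. -/
theorem rho_le_dirichlet {θ : ℝ} (hθ : 0 < θ) (v : ZMod K → ℝ) (hv : ∑ j, v j = 0) :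
    2 * rho K θ * ∑ j, v j ^ 2 ≤ (1 + θ) * ∑ j, (v (j + 1) - v j) ^ 2 := by
  unfold rho
  have := poincare_cycle v hv
  calc _ = (1 + θ) * (4 * Real.sin (Real.pi / K) ^ 2 * ∑ j, v j ^ 2) := by ring
    _ ≤ _ := by gcongr

end Cycle

end FlemingViot

/-! ### Transition semigroups of finite chains. -/

namespace FlemingViot

section Semigroup

variable {S : Type*} [Fintype S] [DecidableEq S]

section Norm

attribute [local instance] Matrix.linftyOpNormedRing Matrix.linftyOpNormedAlgebra

theorem hasDerivAt_transition (A : Matrix S S ℝ) (t : ℝ) :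
    HasDerivAt (transition A) (transition A t * A) t :=
  hasDerivAt_exp_smul_const A t

theorem hasDerivAt_transition' (A : Matrix S S ℝ) (t : ℝ) :
    HasDerivAt (transition A) (A * transition A t) t :=
  hasDerivAt_exp_smul_const' A t

/-- The transition probabilities of a rate matrix are nonnegative. -/
theorem transition_nonneg {A : Matrix S S ℝ} (hA : ∀ x y, x ≠ y → 0 ≤ A x y) {t : ℝ} (ht : 0 ≤ t)
    (x y : S) : 0 ≤ transition A t x y := by
  -- Uniformization: adding a large multiple of the identity makes all entries nonnegative, hence
  -- also the exponential series; the shift costs only the scalar factor e^{-tc}.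
  obtain ⟨c, hc⟩ : ∃ c : ℝ, ∀ x, 0 ≤ c + A x x :=
    ⟨∑ x, |A x x|, fun x => by
      have := Finset.single_le_sum (f := fun x => |A x x|) (fun i _ => abs_nonneg _)
        (Finset.mem_univ x)
      have h2 := neg_abs_le (A x x)
      linarith [this, h2]⟩
  have hB : ∀ x y, 0 ≤ (c • (1 : Matrix S S ℝ) + A) x y := by
    intro x y
    rcases eq_or_ne x y with rfl | h
    · simpa using hc x
    · simpa [Matrix.one_apply_ne h] using hA x y h
  have hpow : ∀ (n : ℕ) x y, 0 ≤ ((t • (c • (1 : Matrix S S ℝ) + A)) ^ n) x y := by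
    intro n
    induction n with
    | zero =>
      intro x y
      rw [pow_zero, Matrix.one_apply]
      split_ifs <;> norm_num
    | succ n ih =>
      intro x y
      rw [pow_succ, Matrix.mul_apply]
      exact Finset.sum_nonneg fun z _ => mul_nonneg (ih x z) (mul_nonneg ht (hB z y))
  have hexp : ∀ x y, 0 ≤ NormedSpace.exp (t • (c • (1 : Matrix S S ℝ) + A)) x y := by
    intro x y
    have hs := NormedSpace.exp_series_hasSum_exp' (𝕂 := ℝ) (t • (c • (1 : Matrix S S ℝ) + A))
    have hs' := (Pi.hasSum.mp (Pi.hasSum.mp hs x)) y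
    refine hs'.nonneg fun n => ?_
    exact mul_nonneg (by positivity) (hpow n x y)
  have hsplit : transition A t
      = Real.exp (-(t * c)) • NormedSpace.exp (t • (c • (1 : Matrix S S ℝ) + A)) := by
    have h1 : t • A = (-(t * c)) • (1 : Matrix S S ℝ) + t • (c • (1 : Matrix S S ℝ) + A) := by
      rw [smul_add, smul_smul, ← add_assoc, ← add_smul]
      simp
    have h2 : NormedSpace.exp ((-(t * c)) • (1 : Matrix S S ℝ))
        = Real.exp (-(t * c)) • (1 : Matrix S S ℝ) := by
      have := NormedSpace.algebraMap_exp_comm (𝕂 := ℝ) (𝔸 := Matrix S S ℝ) (-(t * c))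
      rw [Algebra.algebraMap_eq_smul_one, Algebra.algebraMap_eq_smul_one,
        ← Real.exp_eq_exp_ℝ] at this
      exact this.symm
    rw [transition, h1, Matrix.exp_add_of_commute _ _ ((Commute.one_left _).smul_left _), h2,
      smul_one_mul]
  rw [hsplit]
  exact mul_nonneg (Real.exp_pos _).le (hexp x y)

theorem transition_zero (A : Matrix S S ℝ) : transition A 0 = 1 := by
  rw [transition, zero_smul, NormedSpace.exp_zero]

/-- Used for stationary distributions and for the counting measure on the cycle. -/
theorem vecMul_transition_of_vecMul_eq_zero {A : Matrix S S ℝ} {v : S → ℝ}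
    (h : Matrix.vecMul v A = 0) (t : ℝ) : Matrix.vecMul v (transition A t) = v := by
  have hd : ∀ y s, HasDerivAt (fun s => ∑ x, v x * transition A s x y) 0 s := by
    intro y s
    have h1 := hasDerivAt_transition' A s
    have h2 : HasDerivAt (fun s => ∑ x, v x * transition A s x y)
        (∑ x, v x * (A * transition A s) x y) s :=
      HasDerivAt.fun_sum fun x _ =>
        (hasDerivAt_pi.mp (hasDerivAt_pi.mp h1 x) y).const_mul (v x)
    convert h2 using 1
    have h3 : Matrix.vecMul v (A * transition A s) y = 0 := by
      rw [← Matrix.vecMul_vecMul, h, Matrix.zero_vecMul]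
      rfl
    exact h3.symm
  funext y
  have := is_const_of_deriv_eq_zero (fun s => (hd y s).differentiableAt)
    (fun s => (hd y s).deriv) t 0
  rw [transition_zero] at this
  change ∑ x, v x * transition A t x y = v y
  rw [this]
  simp [Matrix.one_apply]

/-- Relabelling the states is a continuous algebra automorphism, so it commutes with the
exponential. -/
theorem transition_submatrix (A : Matrix S S ℝ) (e : S ≃ S) (h : A.submatrix e e = A) (t : ℝ)
    (x y : S) : transition A t (e x) (e y) = transition A t x y := by
  have hcont : Continuous (Matrix.reindexAlgEquiv ℝ ℝ e.symm) := by
    change Continuous fun M : Matrix S S ℝ => M.submatrix e e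
    exact continuous_id.matrix_submatrix e e
  have h1 := NormedSpace.map_exp (Matrix.reindexAlgEquiv ℝ ℝ e.symm) hcont (t • A)
  have h2 : Matrix.reindexAlgEquiv ℝ ℝ e.symm (t • A) = t • A := by
    rw [map_smul]
    congr 1
  rw [h2] at h1
  exact congrFun (congrFun h1 x) y

end Norm

theorem rateMatrix_mulVec {G : (S → ℝ) → S → ℝ} (hG : IsLinearMap ℝ G) (f : S → ℝ) (x : S) :
    ∑ y, rateMatrix G x y * f y = G f x := by
  change _ = hG.mk' G f x
  conv_rhs => rw [← Finset.univ_sum_single f, map_sum, Finset.sum_apply]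
  refine Finset.sum_congr rfl fun y _ => ?_
  have : (Pi.single y (f y) : S → ℝ) = f y • Pi.single y 1 := by
    rw [← Pi.single_smul, smul_eq_mul, mul_one]
  rw [this, map_smul, Pi.smul_apply, smul_eq_mul, mul_comm]
  rfl

/-- The expectation at time `t` of a function of the chain with initial distribution `μ`. -/
noncomputable def lawExp (A : Matrix S S ℝ) (μ : S → ℝ) (t : ℝ) (f : S → ℝ) : ℝ :=
  ∑ x, (∑ y, μ y * transition A t y x) * f x

variable (A : Matrix S S ℝ) (μ : S → ℝ)

theorem lawExp_zero (f : S → ℝ) : lawExp A μ 0 f = ∑ x, μ x * f x := by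
  simp [lawExp, transition_zero, Matrix.one_apply]

theorem lawExp_add (t : ℝ) (f g : S → ℝ) :
    lawExp A μ t (fun x => f x + g x) = lawExp A μ t f + lawExp A μ t g := by
  simp only [lawExp, mul_add, Finset.sum_add_distrib]

theorem lawExp_sub (t : ℝ) (f g : S → ℝ) :
    lawExp A μ t (fun x => f x - g x) = lawExp A μ t f - lawExp A μ t g := by
  simp only [lawExp, mul_sub, Finset.sum_sub_distrib]

theorem lawExp_const_mul (t c : ℝ) (f : S → ℝ) :
    lawExp A μ t (fun x => c * f x) = c * lawExp A μ t f := by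
  simp only [lawExp, Finset.mul_sum]
  exact Finset.sum_congr rfl fun x _ => by ring

theorem lawExp_sum {ι : Type*} (s : Finset ι) (t : ℝ) (f : ι → S → ℝ) :
    lawExp A μ t (fun x => ∑ i ∈ s, f i x) = ∑ i ∈ s, lawExp A μ t (f i) := by
  simp only [lawExp, Finset.mul_sum]
  rw [Finset.sum_comm]

/-- Kolmogorov's forward equation. -/
theorem hasDerivAt_lawExp (f : S → ℝ) (t : ℝ) :
    HasDerivAt (fun t => lawExp A μ t f) (lawExp A μ t (fun x => ∑ y, A x y * f y)) t := by
  have h1 : ∀ y x, HasDerivAt (fun s => transition A s y x) ((transition A t * A) y x) t :=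
    fun y x => hasDerivAt_pi.mp (hasDerivAt_pi.mp (hasDerivAt_transition A t) y) x
  have h2 : HasDerivAt (fun t => lawExp A μ t f)
      (∑ x, (∑ y, μ y * (transition A t * A) y x) * f x) t :=
    HasDerivAt.fun_sum fun x _ =>
      (HasDerivAt.fun_sum fun y _ => (h1 y x).const_mul (μ y)).mul_const (f x)
  convert h2 using 1
  simp only [lawExp, Matrix.mul_apply, Finset.mul_sum, Finset.sum_mul]
  rw [Finset.sum_comm]
  refine Finset.sum_congr rfl fun x _ => ?_
  rw [Finset.sum_comm]
  conv_rhs => rw [Finset.sum_comm]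
  conv_lhs => rw [Finset.sum_comm]
  refine Finset.sum_congr rfl fun y _ => Finset.sum_congr rfl fun z _ => ?_
  ring

/-- The forward equation for a function depending on time. -/
theorem hasDerivAt_lawExp_sum {ι : Type*} (s : Finset ι) (c c' : ι → ℝ → ℝ) (f : ι → S → ℝ) (t : ℝ)
    (hc : ∀ i ∈ s, HasDerivAt (c i) (c' i t) t) :
    HasDerivAt (fun t => lawExp A μ t (fun x => ∑ i ∈ s, c i t * f i x))
      (lawExp A μ t (fun x => ∑ i ∈ s, c' i t * f i x)
        + lawExp A μ t (fun x => ∑ y, A x y * ∑ i ∈ s, c i t * f i y)) t := by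
  have h : HasDerivAt (fun t => ∑ i ∈ s, c i t * lawExp A μ t (f i))
      (∑ i ∈ s, (c' i t * lawExp A μ t (f i)
        + c i t * lawExp A μ t (fun x => ∑ y, A x y * f i y))) t :=
    HasDerivAt.fun_sum fun i hi => (hc i hi).mul (hasDerivAt_lawExp A μ (f i) t)
  have h2 : (fun x => ∑ y, A x y * ∑ i ∈ s, c i t * f i y)
      = fun x => ∑ i ∈ s, c i t * ∑ y, A x y * f i y := by
    funext x
    simp only [Finset.mul_sum]
    rw [Finset.sum_comm]
    exact Finset.sum_congr rfl fun i _ => Finset.sum_congr rfl fun y _ => by ring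
  have h3 : ∀ (d : ι → ℝ) (g : ι → S → ℝ), lawExp A μ t (fun x => ∑ i ∈ s, d i * g i x)
      = ∑ i ∈ s, d i * lawExp A μ t (g i) := fun d g => by
    rw [lawExp_sum]
    exact Finset.sum_congr rfl fun i _ => lawExp_const_mul A μ t (d i) (g i)
  have h4 : (fun t => lawExp A μ t (fun x => ∑ i ∈ s, c i t * f i x))
      = fun t => ∑ i ∈ s, c i t * lawExp A μ t (f i) := by
    funext u
    rw [lawExp_sum]
    exact Finset.sum_congr rfl fun i _ => lawExp_const_mul A μ u (c i u) (f i)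
  rw [h2, h4, h3, h3, ← Finset.sum_add_distrib]
  exact h

variable {A}

theorem lawExp_of_vecMul_eq_zero (h : Matrix.vecMul μ A = 0) (t : ℝ) (f : S → ℝ) :
    lawExp A μ t f = ∑ x, μ x * f x := by
  have := vecMul_transition_of_vecMul_eq_zero h t
  exact Finset.sum_congr rfl fun x _ => by rw [← congrFun this x]; rfl

section Chain

variable [MeasurableSpace S] [MeasurableSingletonClass S] {Ω : Type*} [MeasurableSpace Ω]
  {P : Measure Ω} {X : ℝ≥0 → Ω → S} {m : Measure S}

/-- Only one-time marginals enter the theorem, so the single-time case of `fdd` suffices. -/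
theorem IsMarkovChain.map_real (hX : IsMarkovChain A m P X) (t : ℝ≥0) (x : S) :
    (P.map (X t)).real {x} = ∑ y, m.real {y} * transition A t y x := by
  have h := hX.fdd 0 (fun _ => t) monotone_const (fun _ => x)
  simp only [Finset.univ_eq_empty, Finset.prod_empty, mul_one] at h
  rw [← h, map_measureReal_apply (hX.measurable t) (measurableSet_singleton x)]
  congr 1
  ext ω
  simp

theorem IsMarkovChain.integral_map (hX : IsMarkovChain A m P X) [IsProbabilityMeasure P] (t : ℝ≥0)
    (f : S → ℝ) : ∫ x, f x ∂(P.map (X t)) = lawExp A (fun y => m.real {y}) t f := by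
  have := Measure.isProbabilityMeasure_map (μ := P) (hX.measurable t).aemeasurable
  rw [integral_fintype (Integrable.of_finite)]
  exact Finset.sum_congr rfl fun x _ => by rw [hX.map_real, smul_eq_mul]

theorem IsMarkovChain.integral_comp (hX : IsMarkovChain A m P X) [IsProbabilityMeasure P] (t : ℝ≥0)
    (f : S → ℝ) : ∫ ω, f (X t ω) ∂P = lawExp A (fun y => m.real {y}) t f := by
  rw [← hX.integral_map, MeasureTheory.integral_map (hX.measurable t).aemeasurable
    (measurable_of_countable f).aestronglyMeasurable]

theorem IsMarkovChain.variance_comp (hX : IsMarkovChain A m P X) [IsProbabilityMeasure P] (t : ℝ≥0)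
    (f : S → ℝ) : variance (fun ω => f (X t ω)) P
      = lawExp A (fun y => m.real {y}) t (fun x => f x ^ 2)
        - lawExp A (fun y => m.real {y}) t f ^ 2 := by
  have := Measure.isProbabilityMeasure_map (μ := P) (hX.measurable t).aemeasurable
  have hf : Measurable f := measurable_of_countable f
  have h1 : variance (fun ω => f (X t ω)) P = variance f (P.map (X t)) :=
    (variance_map hf.aemeasurable (hX.measurable t).aemeasurable).symm
  rw [h1, variance_eq_sub (MemLp.of_discrete), ← hX.integral_map, ← hX.integral_map]
  rfl

end Chain

end Semigroup

end FlemingViot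

/-! ### The particle generator on linear and quadratic functionals. -/

namespace FlemingViot

section Generators

variable {K : ℕ} [NeZero K] {N : ℕ}

/-- The integral `∑ₐ w(a) η(a) / N` of `w` against the empirical distribution of `η`. -/
noncomputable def lin (w : ZMod K → ℝ) (η : Config K N) : ℝ := ∑ a, w a * ((η.1 a : ℝ) / N)

/-- The carré du champ of the walk on the cycle. -/
def carre (θ : ℝ) (w : ZMod K → ℝ) (i : ZMod K) : ℝ :=
  (w (i + 1) - w i) ^ 2 + θ * (w (i - 1) - w i) ^ 2

omit [NeZero K] in
theorem isLinearMap_walkGenerator (θ : ℝ) : IsLinearMap ℝ (walkGenerator K θ) where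
  map_add f g := by
    funext x
    simp only [walkGenerator, Pi.add_apply]
    ring
  map_smul c f := by
    funext x
    simp only [walkGenerator, Pi.smul_apply, smul_eq_mul]
    ring

theorem isLinearMap_particleGenerator (θ p : ℝ) :
    IsLinearMap ℝ (particleGenerator K N θ p) where
  map_add f g := by
    funext x
    simp only [particleGenerator, Pi.add_apply, ← Finset.sum_add_distrib]
    exact Finset.sum_congr rfl fun i _ => Finset.sum_congr rfl fun j _ => by ring
  map_smul c f := by
    funext x
    simp only [particleGenerator, Pi.smul_apply, smul_eq_mul, Finset.mul_sum]
    exact Finset.sum_congr rfl fun i _ => Finset.sum_congr rfl fun j _ => by ring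

theorem sum_count (η : Config K N) : ∑ a, (η.1 a : ℝ) = N := by
  exact_mod_cast η.2

theorem sum_density (hN : N ≠ 0) (η : Config K N) : ∑ a, (η.1 a : ℝ) / N = 1 := by
  rw [← Finset.sum_div, sum_count, div_self (by exact_mod_cast hN)]

theorem lin_eq_sum_div (w : ZMod K → ℝ) (η : Config K N) :
    lin w η = (∑ a, (η.1 a : ℝ) * w a) / N := by
  rw [lin, Finset.sum_div]
  exact Finset.sum_congr rfl fun a _ => by ring

theorem lin_const (hN : N ≠ 0) (c : ℝ) (η : Config K N) : lin (fun _ => c) η = c := by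
  rw [lin, ← Finset.mul_sum, sum_density hN, mul_one]

theorem lin_single (k : ZMod K) (η : Config K N) : lin (Pi.single k 1) η = (η.1 k : ℝ) / N := by
  simp [lin, Pi.single_apply]

theorem lin_move (w : ZMod K → ℝ) (η : Config K N) (i j : ZMod K) (hi : 0 < η.1 i) :
    lin w (η.move i j) = lin w η + (w j - w i) / N := by
  have h : ∀ k, (((η.move i j).1 k : ℕ) : ℝ)
      = (η.1 k : ℝ) - (if k = i then 1 else 0) + (if k = j then 1 else 0) := by
    intro k
    have h1 : (η.move i j).1 k
        = η.1 k - (if k = i then 1 else 0) + (if k = j then 1 else 0) := by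
      simp only [Config.move, dif_pos hi]
    have h2 : (if k = i then 1 else 0) ≤ η.1 k := by
      split_ifs with hk
      · subst hk; exact hi
      · exact Nat.zero_le _
    rw [h1]
    push_cast [Nat.cast_sub h2]
    rfl
  rw [lin_eq_sum_div, lin_eq_sum_div, ← add_div]
  congr 1
  simp only [h, add_mul, sub_mul, ite_mul, one_mul, zero_mul, Finset.sum_add_distrib,
    Finset.sum_sub_distrib, Finset.sum_ite_eq', Finset.mem_univ, if_true]
  ring

/-- Increments out of empty sites carry weight zero, so `d` need only be correct where a particle is
present. -/
theorem particleGenerator_eq (θ p : ℝ) (f : Config K N → ℝ) (η : Config K N)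
    (d : ZMod K → ZMod K → ℝ) (h : ∀ i j, 0 < η.1 i → f (η.move i j) - f η = d i j) :
    particleGenerator K N θ p f η
      = ∑ i, (η.1 i : ℝ) * (d i (i + 1) + θ * d i (i - 1))
        + p / ((N : ℝ) - 1) * ∑ i, ∑ j, (η.1 i : ℝ) * η.1 j * d i j := by
  rw [particleGenerator, Finset.mul_sum, ← Finset.sum_add_distrib]
  refine Finset.sum_congr rfl fun i _ => ?_
  have h1 : ∀ j, (η.1 i : ℝ) * (f (η.move i j) - f η) = η.1 i * d i j := by
    intro j
    rcases Nat.eq_zero_or_pos (η.1 i) with h0 | h0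
    · simp [h0]
    · rw [h i j h0]
  simp only [h1, mul_add, Finset.sum_add_distrib, mul_ite, mul_one, mul_zero, Finset.sum_ite_eq',
    Finset.mem_univ, if_true, Finset.mul_sum]
  congr 1
  · ring
  · exact Finset.sum_congr rfl fun j _ => by ring

/-- Antisymmetry in the two sites. This is why the interaction leaves mean profiles untouched. -/
theorem sum_sum_count_mul_sub (η : Config K N) (w : ZMod K → ℝ) :
    ∑ i, ∑ j, (η.1 i : ℝ) * η.1 j * (w j - w i) = 0 := by
  have h : ∑ i, ∑ j, (η.1 i : ℝ) * η.1 j * (w j - w i)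
      = -∑ i, ∑ j, (η.1 i : ℝ) * η.1 j * (w j - w i) := by
    conv_lhs => rw [Finset.sum_comm]
    simp only [← Finset.sum_neg_distrib]
    exact Finset.sum_congr rfl fun i _ => Finset.sum_congr rfl fun j _ => by ring
  linarith

theorem particleGenerator_lin (θ p : ℝ) (w : ZMod K → ℝ) (η : Config K N) :
    particleGenerator K N θ p (lin w) η = lin (walkGenerator K θ w) η := by
  rw [particleGenerator_eq θ p _ η (fun i j => (w j - w i) / N)
    (fun i j hi => by rw [lin_move w η i j hi]; ring)]
  have h : ∑ i, ∑ j, (η.1 i : ℝ) * η.1 j * ((w j - w i) / N) = 0 := by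
    simp only [← mul_div_assoc, ← Finset.sum_div]
    rw [sum_sum_count_mul_sub, zero_div]
  rw [h, mul_zero, add_zero, lin_eq_sum_div, Finset.sum_div]
  exact Finset.sum_congr rfl fun i _ => by unfold walkGenerator; ring

theorem sum_sum_count_mul_sub_sq (η : Config K N) (w : ZMod K → ℝ) (hN : N ≠ 0) :
    ∑ i, ∑ j, (η.1 i : ℝ) * η.1 j * ((w j - w i) / N) ^ 2
      = 2 * (lin (fun a => w a ^ 2) η - lin w η ^ 2) := by
  have hN' : (N : ℝ) ≠ 0 := by exact_mod_cast hN
  have h1 : ∀ i j : ZMod K, (η.1 i : ℝ) * η.1 j * ((w j - w i) / N) ^ 2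
      = (w j ^ 2 * (η.1 j / N)) * (η.1 i / N) + (η.1 j / N) * (w i ^ 2 * (η.1 i / N))
        - 2 * ((w j * (η.1 j / N)) * (w i * (η.1 i / N))) := by
    intro i j
    field_simp
    ring
  simp only [h1, Finset.sum_add_distrib, Finset.sum_sub_distrib, ← Finset.sum_mul,
    ← Finset.mul_sum, sum_density hN]
  unfold lin
  ring

/-- Expand (x + δ)² - x² = 2xδ + δ². The part linear in δ sees only the walk. The squares of walk
jumps give the carré du champ, and those of redistribution jumps give twice an empirical variance,
with rate p/(N-1), hence `pN`. -/
theorem particleGenerator_lin_sq (θ p : ℝ) (w : ZMod K → ℝ) (η : Config K N) (hN : N ≠ 0) :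
    particleGenerator K N θ p (fun ξ => lin w ξ ^ 2) η
      = 2 * lin w η * lin (walkGenerator K θ w) η + 1 / N * lin (carre θ w) η
        + pN N p * (lin (fun a => w a ^ 2) η - lin w η ^ 2) := by
  rw [particleGenerator_eq θ p _ η
    (fun i j => 2 * lin w η * ((w j - w i) / N) + ((w j - w i) / N) ^ 2)
    (fun i j hi => by rw [lin_move w η i j hi]; ring)]
  have h : ∑ i, ∑ j, (η.1 i : ℝ) * η.1 j
      * (2 * lin w η * ((w j - w i) / N) + ((w j - w i) / N) ^ 2)
      = 2 * (lin (fun a => w a ^ 2) η - lin w η ^ 2) := by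
    rw [← sum_sum_count_mul_sub_sq η w hN]
    have h0 : ∑ i, ∑ j, (2 * lin w η / N) * ((η.1 i : ℝ) * η.1 j * (w j - w i)) = 0 := by
      simp only [← Finset.mul_sum]
      rw [sum_sum_count_mul_sub, mul_zero]
    rw [← zero_add (∑ i, ∑ j, (η.1 i : ℝ) * η.1 j * ((w j - w i) / N) ^ 2), ← h0]
    simp only [← Finset.sum_add_distrib]
    exact Finset.sum_congr rfl fun i _ => Finset.sum_congr rfl fun j _ => by ring
  rw [h]
  have h2 : ∑ i, (η.1 i : ℝ) * ((2 * lin w η * ((w (i + 1) - w i) / N) + ((w (i + 1) - w i) / N) ^ 2)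
      + θ * (2 * lin w η * ((w (i - 1) - w i) / N) + ((w (i - 1) - w i) / N) ^ 2))
      = 2 * lin w η * lin (walkGenerator K θ w) η + 1 / N * lin (carre θ w) η := by
    conv_rhs => rw [lin.eq_def (walkGenerator K θ w), lin.eq_def (carre θ w), Finset.mul_sum,
      Finset.mul_sum, ← Finset.sum_add_distrib]
    refine Finset.sum_congr rfl fun i _ => ?_
    unfold walkGenerator carre
    ring
  rw [h2, pN]
  ring

variable (θ p : ℝ) (μ : Config K N → ℝ)

/-- The expectation at time `t` of a function of the particle system with initial
distribution `μ`. -/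
noncomputable def particleExp (t : ℝ) (f : Config K N → ℝ) : ℝ :=
  lawExp (rateMatrix (particleGenerator K N θ p)) μ t f

theorem hasDerivAt_particleExp (f : Config K N → ℝ) (t : ℝ) :
    HasDerivAt (fun t => particleExp θ p μ t f)
      (particleExp θ p μ t (particleGenerator K N θ p f)) t := by
  have := hasDerivAt_lawExp (rateMatrix (particleGenerator K N θ p)) μ f t
  simp only [rateMatrix_mulVec (isLinearMap_particleGenerator θ p)] at this
  exact this

theorem particleExp_const (hμ : ∑ x, μ x = 1) (t c : ℝ) :
    particleExp θ p μ t (fun _ => c) = c := by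
  have hd : ∀ s, HasDerivAt (fun t => particleExp θ p μ t (fun _ => c)) 0 s := by
    intro s
    have h := hasDerivAt_particleExp θ p μ (fun _ => c) s
    have h0 : particleGenerator K N θ p (fun _ => c) = fun _ => 0 := by
      funext η
      simp [particleGenerator]
    rw [h0] at h
    convert h using 1
    simp [particleExp, lawExp]
  have := is_const_of_deriv_eq_zero (fun s => (hd s).differentiableAt) (fun s => (hd s).deriv) t 0
  rw [this, particleExp, lawExp_zero, ← Finset.sum_mul, hμ, one_mul]

/-- The expected proportion of particles at each site. -/
noncomputable def meanDensity (t : ℝ) (a : ZMod K) : ℝ :=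
  particleExp θ p μ t (fun η => (η.1 a : ℝ) / N)

theorem particleExp_lin (t : ℝ) (w : ZMod K → ℝ) :
    particleExp θ p μ t (lin w) = ∑ a, w a * meanDensity θ p μ t a := by
  unfold meanDensity particleExp
  simp only [← lawExp_const_mul]
  rw [← lawExp_sum]
  rfl

/-- A family of test functions transported backwards by the walk has constant mean. -/
theorem hasDerivAt_particleExp_lin (w : ℝ → ZMod K → ℝ) (s : ℝ)
    (hw : ∀ a, HasDerivAt (fun s => w s a) (-walkGenerator K θ (w s) a) s) :
    HasDerivAt (fun s => particleExp θ p μ s (lin (w s))) 0 s := by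
  have h := hasDerivAt_lawExp_sum (rateMatrix (particleGenerator K N θ p)) μ Finset.univ
    (fun a s => w s a) (fun a s => -walkGenerator K θ (w s) a)
    (fun a η => (η.1 a : ℝ) / N) s (fun a _ => hw a)
  simp only [rateMatrix_mulVec (isLinearMap_particleGenerator θ p)] at h
  refine h.congr_deriv ?_
  symm
  rw [← lawExp_add]
  have h0 : ∀ η : Config K N, ∑ a, -walkGenerator K θ (w s) a * ((η.1 a : ℝ) / N)
      + particleGenerator K N θ p (lin (w s)) η = 0 := by
    intro η
    rw [particleGenerator_lin, lin, ← Finset.sum_add_distrib]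
    exact Finset.sum_eq_zero fun a _ => by ring
  have h1 : (fun η : Config K N => ∑ a, -walkGenerator K θ (w s) a * ((η.1 a : ℝ) / N)
      + particleGenerator K N θ p (lin (w s)) η) = fun _ => 0 := funext h0
  change 0 = lawExp _ μ s (fun η : Config K N => ∑ a, -walkGenerator K θ (w s) a
    * ((η.1 a : ℝ) / N) + particleGenerator K N θ p (lin (w s)) η)
  rw [h1]
  simp [lawExp]

/-- This separates the time-dependent coefficients from fixed functions of η, the form
`hasDerivAt_lawExp_sum` works with. -/
theorem lin_sq (w : ZMod K → ℝ) (η : Config K N) :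
    lin w η ^ 2 = ∑ x : ZMod K × ZMod K,
      (w x.1 * w x.2) * (((η.1 x.1 : ℝ) / N) * ((η.1 x.2 : ℝ) / N)) := by
  rw [sq, lin, Finset.sum_mul_sum, Fintype.sum_prod_type]
  exact Finset.sum_congr rfl fun i _ => Finset.sum_congr rfl fun j _ => by ring

/-- The second moment of a family of test functions transported backwards by the walk. -/
theorem hasDerivAt_particleExp_lin_sq (hN : N ≠ 0) (w : ℝ → ZMod K → ℝ) (s : ℝ)
    (hw : ∀ a, HasDerivAt (fun s => w s a) (-walkGenerator K θ (w s) a) s) :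
    HasDerivAt (fun s => particleExp θ p μ s (fun η => lin (w s) η ^ 2))
      (1 / N * particleExp θ p μ s (lin (carre θ (w s)))
        + pN N p * (particleExp θ p μ s (lin (fun a => w s a ^ 2))
          - particleExp θ p μ s (fun η => lin (w s) η ^ 2))) s := by
  have h := hasDerivAt_lawExp_sum (rateMatrix (particleGenerator K N θ p)) μ Finset.univ
    (fun x : ZMod K × ZMod K => fun s => w s x.1 * w s x.2)
    (fun x s => -walkGenerator K θ (w s) x.1 * w s x.2 + w s x.1 * -walkGenerator K θ (w s) x.2)
    (fun x η => ((η.1 x.1 : ℝ) / N) * ((η.1 x.2 : ℝ) / N)) s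
    (fun x _ => (hw x.1).mul (hw x.2))
  simp only [rateMatrix_mulVec (isLinearMap_particleGenerator θ p), ← lin_sq] at h
  refine h.congr_deriv ?_
  symm
  rw [← lawExp_add]
  unfold particleExp
  rw [← lawExp_sub, ← lawExp_const_mul, ← lawExp_const_mul, ← lawExp_add]
  congr 1
  funext η
  rw [particleGenerator_lin_sq θ p (w s) η hN]
  have h1 : ∑ x : ZMod K × ZMod K,
      (-walkGenerator K θ (w s) x.1 * w s x.2 + w s x.1 * -walkGenerator K θ (w s) x.2)
        * (((η.1 x.1 : ℝ) / N) * ((η.1 x.2 : ℝ) / N))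
      = -(2 * lin (w s) η * lin (walkGenerator K θ (w s)) η) := by
    have h2 : lin (w s) η * lin (walkGenerator K θ (w s)) η
        = ∑ x : ZMod K × ZMod K, (w s x.1 * ((η.1 x.1 : ℝ) / N))
          * (walkGenerator K θ (w s) x.2 * ((η.1 x.2 : ℝ) / N)) := by
      rw [lin, lin, Finset.sum_mul_sum, Fintype.sum_prod_type]
    have h3 : lin (walkGenerator K θ (w s)) η * lin (w s) η
        = ∑ x : ZMod K × ZMod K, (walkGenerator K θ (w s) x.1 * ((η.1 x.1 : ℝ) / N))
          * (w s x.2 * ((η.1 x.2 : ℝ) / N)) := by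
      rw [lin, lin, Finset.sum_mul_sum, Fintype.sum_prod_type]
    have h4 : 2 * lin (w s) η * lin (walkGenerator K θ (w s)) η
        = lin (w s) η * lin (walkGenerator K θ (w s)) η
          + lin (walkGenerator K θ (w s)) η * lin (w s) η := by ring
    rw [h4, h2, h3, ← Finset.sum_add_distrib, ← Finset.sum_neg_distrib]
    exact Finset.sum_congr rfl fun x _ => by ring
  rw [h1]
  ring

end Generators

end FlemingViot

/-! ### Energy decay for the walk on the cycle. -/

namespace FlemingViot

/-- Grönwall through the integrating factor e^{cs}; the inequality is required only for s ≥ 0, where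
the transition matrices are known to be nonnegative. -/
theorem le_exp_mul_of_deriv_le {f f' : ℝ → ℝ} {c : ℝ} (hf : ∀ s, HasDerivAt f (f' s) s)
    (h : ∀ s, 0 ≤ s → f' s ≤ -c * f s) {t : ℝ} (ht : 0 ≤ t) :
    f t ≤ Real.exp (-c * t) * f 0 := by
  have hd : ∀ s, HasDerivAt (fun s => Real.exp (c * s) * f s)
      (Real.exp (c * s) * (c * f s + f' s)) s := by
    intro s
    have h1 : HasDerivAt (fun s => c * s) c s := by simpa using (hasDerivAt_id s).const_mul c
    exact (h1.exp.mul (hf s)).congr_deriv (by ring)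
  have hanti : AntitoneOn (fun s => Real.exp (c * s) * f s) (Set.Ici 0) := by
    refine antitoneOn_of_deriv_nonpos (convex_Ici 0)
      (fun s _ => (hd s).continuousAt.continuousWithinAt)
      (fun s _ => (hd s).differentiableAt.differentiableWithinAt) fun s hs => ?_
    rw [(hd s).deriv]
    rw [interior_Ici] at hs
    have := h s (le_of_lt hs)
    exact mul_nonpos_of_nonneg_of_nonpos (Real.exp_pos _).le (by linarith)
  have h2 := hanti (Set.self_mem_Ici) (Set.mem_Ici.mpr ht) ht
  simp only [mul_zero, Real.exp_zero, one_mul] at h2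
  calc f t = Real.exp (-c * t) * (Real.exp (c * t) * f t) := by
        rw [← mul_assoc, ← Real.exp_add]
        simp
    _ ≤ _ := by gcongr

section Walk

variable {K : ℕ} [NeZero K]

/-- The adjoint of the generator of the walk on the cycle. -/
def walkAdjoint (θ : ℝ) (v : ZMod K → ℝ) (a : ZMod K) : ℝ :=
  (v (a - 1) - v a) + θ * (v (a + 1) - v a)

theorem sum_add_one (f : ZMod K → ℝ) : ∑ a, f (a + 1) = ∑ a, f a :=
  Equiv.sum_comp (Equiv.addRight 1) f

theorem sum_sub_one (f : ZMod K → ℝ) : ∑ a, f (a - 1) = ∑ a, f a :=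
  Equiv.sum_comp (Equiv.subRight 1) f

theorem sum_walkAdjoint (θ : ℝ) (v : ZMod K → ℝ) : ∑ a, walkAdjoint θ v a = 0 := by
  simp only [walkAdjoint, Finset.sum_add_distrib, Finset.sum_sub_distrib, ← Finset.mul_sum,
    sum_add_one, sum_sub_one]
  ring

/-- The drift is antisymmetric and drops out of the energy, leaving the symmetric Dirichlet form
with total rate 1 + θ. -/
theorem sum_mul_walkAdjoint (θ : ℝ) (v : ZMod K → ℝ) :
    2 * ∑ a, v a * walkAdjoint θ v a = -((1 + θ) * ∑ a, (v (a + 1) - v a) ^ 2) := by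
  have h1 : ∑ a, v (a + 1) ^ 2 = ∑ a, v a ^ 2 := sum_add_one fun a => v a ^ 2
  have h2 : ∑ a, v a * v (a - 1) = ∑ a, v (a + 1) * v a := by
    rw [← sum_add_one]
    simp
  have h3 : ∑ a, v a * walkAdjoint θ v a
      = ∑ a, v a * v (a - 1) - ∑ a, v a ^ 2 + θ * (∑ a, v (a + 1) * v a - ∑ a, v a ^ 2) := by
    rw [← Finset.sum_sub_distrib, ← Finset.sum_sub_distrib, Finset.mul_sum,
      ← Finset.sum_add_distrib]
    exact Finset.sum_congr rfl fun a _ => by unfold walkAdjoint; ring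
  have h4 : ∑ a, (v (a + 1) - v a) ^ 2
      = ∑ a, v (a + 1) ^ 2 + ∑ a, v a ^ 2 - 2 * ∑ a, v (a + 1) * v a := by
    rw [Finset.mul_sum, ← Finset.sum_add_distrib, ← Finset.sum_sub_distrib]
    exact Finset.sum_congr rfl fun a _ => by ring
  rw [h3, h4, h1, h2]
  ring

section Energy

variable {θ : ℝ} {v : ℝ → ZMod K → ℝ}

theorem sum_eq_of_hasDerivAt (hv : ∀ a s, HasDerivAt (fun s => v s a) (walkAdjoint θ (v s) a) s)
    (t : ℝ) : ∑ a, v t a = ∑ a, v 0 a := by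
  have hd : ∀ s, HasDerivAt (fun s => ∑ a, v s a) 0 s := fun s =>
    (HasDerivAt.fun_sum fun a _ => hv a s).congr_deriv (sum_walkAdjoint θ (v s))
  exact is_const_of_deriv_eq_zero (fun s => (hd s).differentiableAt) (fun s => (hd s).deriv) t 0

theorem hasDerivAt_sum_sq (hv : ∀ a s, HasDerivAt (fun s => v s a) (walkAdjoint θ (v s) a) s)
    (s : ℝ) : HasDerivAt (fun s => ∑ a, v s a ^ 2)
      (-((1 + θ) * ∑ a, (v s (a + 1) - v s a) ^ 2)) s := by
  refine (HasDerivAt.fun_sum fun a _ => (hv a s).pow 2).congr_deriv ?_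
  rw [← sum_mul_walkAdjoint, Finset.mul_sum]
  exact Finset.sum_congr rfl fun a _ => by push_cast; ring

/-- The walk on the cycle contracts zero-sum vectors at rate `rho K θ`. -/
theorem sum_sq_le_exp_rho (hθ : 0 < θ)
    (hv : ∀ a s, HasDerivAt (fun s => v s a) (walkAdjoint θ (v s) a) s)
    (h0 : ∑ a, v 0 a = 0) {t : ℝ} (ht : 0 ≤ t) :
    ∑ a, v t a ^ 2 ≤ Real.exp (-(2 * rho K θ) * t) * ∑ a, v 0 a ^ 2 := by
  refine le_exp_mul_of_deriv_le (hasDerivAt_sum_sq hv) (fun s _ => ?_) ht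
  have := rho_le_dirichlet hθ (v s) (by rw [sum_eq_of_hasDerivAt hv, h0])
  linarith

/-- The walk on the cycle contracts vectors at most at rate `alpha K θ`. -/
theorem exp_alpha_le_sum_sq (hθ : 0 < θ)
    (hv : ∀ a s, HasDerivAt (fun s => v s a) (walkAdjoint θ (v s) a) s) {t : ℝ} (ht : 0 ≤ t) :
    Real.exp (-(2 * alpha K θ) * t) * ∑ a, v 0 a ^ 2 ≤ ∑ a, v t a ^ 2 := by
  -- Applied to minus the energy, the upper Grönwall bound becomes a lower bound.
  have h := le_exp_mul_of_deriv_le (c := 2 * alpha K θ)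
    (fun s => (hasDerivAt_sum_sq hv s).neg) (fun s _ => ?_) ht
  · simp only [Pi.neg_apply] at h
    linarith
  · have := dirichlet_le_alpha hθ (v s)
    simp only [Pi.neg_apply]
    linarith

end Energy

omit [NeZero K] in
theorem rho_pos (hK : 3 ≤ K) {θ : ℝ} (hθ : 0 < θ) : 0 < rho K θ := by
  have hK' : (3 : ℝ) ≤ K := by exact_mod_cast hK
  have hs : 0 < Real.sin (Real.pi / K) := by
    apply Real.sin_pos_of_pos_of_lt_pi (by positivity)
    rw [div_lt_iff₀ (by linarith)]
    nlinarith [Real.pi_pos]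
  unfold rho
  positivity

theorem sum_mul_walkGenerator_single (θ : ℝ) (v : ZMod K → ℝ) (k : ZMod K) :
    ∑ a, v a * walkGenerator K θ (Pi.single k 1) a = walkAdjoint θ v k := by
  have h1 : ∀ a : ZMod K, (a + 1 = k) = (a = k - 1) := fun a => propext eq_sub_iff_add_eq.symm
  have h2 : ∀ a : ZMod K, (a - 1 = k) = (a = k + 1) := fun a => propext sub_eq_iff_eq_add
  have h : ∀ a, v a * walkGenerator K θ (Pi.single k 1) a
      = (if a = k - 1 then v a else 0) - (if a = k then v a else 0)
        + θ * ((if a = k + 1 then v a else 0) - (if a = k then v a else 0)) := by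
    intro a
    simp only [walkGenerator, Pi.single_apply, h1, h2]
    split_ifs <;> ring
  simp only [h, Finset.sum_add_distrib, Finset.sum_sub_distrib, ← Finset.mul_sum,
    Finset.sum_ite_eq', Finset.mem_univ, if_true, walkAdjoint]

/-- The transition matrix of the walk on the cycle. -/
noncomputable def walkTransition (θ t : ℝ) : Matrix (ZMod K) (ZMod K) ℝ :=
  transition (rateMatrix (walkGenerator K θ)) t

theorem walkTransition_nonneg {θ : ℝ} (hθ : 0 < θ) {t : ℝ} (ht : 0 ≤ t) (a b : ZMod K) :
    0 ≤ walkTransition θ t a b := by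
  refine transition_nonneg (fun x y hxy => ?_) ht a b
  have h : ∀ z, 0 ≤ (Pi.single y 1 : ZMod K → ℝ) z := fun z => by
    rw [Pi.single_apply]; split_ifs <;> norm_num
  change 0 ≤ (_ - (Pi.single y 1 : ZMod K → ℝ) x) + θ * (_ - (Pi.single y 1 : ZMod K → ℝ) x)
  rw [Pi.single_eq_of_ne hxy, sub_zero, sub_zero]
  exact add_nonneg (h _) (mul_nonneg hθ.le (h _))

/-- The sum runs over starting points: counting measure is invariant, so the backward test functions
a ↦ P_{t-s}(a, k) have total mass one. -/
theorem sum_walkTransition (θ t : ℝ) (b : ZMod K) : ∑ a, walkTransition θ t a b = 1 := by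
  have h : Matrix.vecMul (fun _ => 1) (rateMatrix (walkGenerator K θ)) = 0 := by
    funext y
    have := sum_mul_walkGenerator_single θ (fun _ : ZMod K => 1) y
    simp only [walkAdjoint, sub_self, mul_zero, add_zero] at this
    exact this
  have h2 := congrFun (vecMul_transition_of_vecMul_eq_zero h t) b
  simpa [Matrix.vecMul, dotProduct, walkTransition] using h2

theorem walkTransition_add_right (θ t : ℝ) (a b c : ZMod K) :
    walkTransition θ t (a + c) (b + c) = walkTransition θ t a b := by
  refine transition_submatrix _ (Equiv.addRight c) ?_ t a b
  ext x y
  have h1 : ∀ z, (z + c + 1 = y + c) = (z + 1 = y) := fun z => propext <| by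
    rw [add_right_comm, add_left_inj]
  have h2 : ∀ z, (z + c - 1 = y + c) = (z - 1 = y) := fun z => propext <| by
    rw [add_sub_right_comm, add_left_inj]
  simp only [Matrix.submatrix_apply, rateMatrix, Matrix.of_apply, walkGenerator, Pi.single_apply,
    Equiv.coe_addRight, h1, h2, add_left_inj]

theorem walkTransition_zero (θ : ℝ) (k : ZMod K) :
    (fun a => walkTransition θ 0 a k) = Pi.single k 1 := by
  funext a
  rw [walkTransition, transition_zero, Matrix.one_apply, Pi.single_apply]

/-- The backward equation in the remaining time t - s; it provides the test functions required by
`hasDerivAt_particleExp_lin`. -/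
theorem hasDerivAt_walkTransition_sub (θ t s : ℝ) (a k : ZMod K) :
    HasDerivAt (fun s => walkTransition θ (t - s) a k)
      (-walkGenerator K θ (fun b => walkTransition θ (t - s) b k) a) s := by
  have h1 := hasDerivAt_pi.mp (hasDerivAt_pi.mp
    (hasDerivAt_transition' (rateMatrix (walkGenerator K θ)) (t - s)) a) k
  have h2 : HasDerivAt (fun s => t - s) (-1) s := by
    simpa using (hasDerivAt_id s).const_sub t
  refine (h1.comp s h2).congr_deriv ?_
  rw [Matrix.mul_apply, mul_neg_one]
  congr 1
  exact rateMatrix_mulVec (isLinearMap_walkGenerator θ) _ a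

/-- The law of the walk at time `t`. -/
theorem hasDerivAt_walkLaw (θ : ℝ) (μ : ZMod K → ℝ) (k : ZMod K) (s : ℝ) :
    HasDerivAt (fun s => ∑ a, μ a * walkTransition θ s a k)
      (walkAdjoint θ (fun b => ∑ a, μ a * walkTransition θ s a b) k) s := by
  have h := hasDerivAt_lawExp (rateMatrix (walkGenerator K θ)) μ (Pi.single k 1) s
  simp only [rateMatrix_mulVec (isLinearMap_walkGenerator θ)] at h
  rw [lawExp, sum_mul_walkGenerator_single] at h
  simpa [lawExp, Pi.single_apply, walkTransition] using h

end Walk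

end FlemingViot

/-! ### Evolution of means and variances, and the stationary regime. -/

namespace FlemingViot

section Variance

variable {K : ℕ} [NeZero K] {N : ℕ} {θ p : ℝ} {μ : Config K N → ℝ}

theorem pN_pos (hN : 2 ≤ N) (hp : 0 < p) : 0 < pN N p := by
  have : (2 : ℝ) ≤ N := by exact_mod_cast hN
  have h : (0 : ℝ) < N - 1 := by linarith
  unfold pN
  positivity

theorem particleExp_nonneg (hN : 2 ≤ N) (hθ : 0 < θ) (hp : 0 < p) (hμ : ∀ x, 0 ≤ μ x) {t : ℝ}
    (ht : 0 ≤ t) {f : Config K N → ℝ} (hf : ∀ x, 0 ≤ f x) : 0 ≤ particleExp θ p μ t f := by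
  refine Finset.sum_nonneg fun x _ => mul_nonneg (Finset.sum_nonneg fun y _ =>
    mul_nonneg (hμ y) (transition_nonneg (fun η ξ hne => ?_) ht y x)) (hf x)
  have h : ∀ ζ, 0 ≤ (Pi.single ξ 1 : Config K N → ℝ) ζ := fun ζ => by
    rw [Pi.single_apply]; split_ifs <;> norm_num
  have hN' : (0 : ℝ) ≤ N - 1 := by
    have : (2 : ℝ) ≤ N := by exact_mod_cast hN
    linarith
  refine Finset.sum_nonneg fun i _ => Finset.sum_nonneg fun j _ => mul_nonneg
    (mul_nonneg (Nat.cast_nonneg _) ?_) ?_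
  · rw [Pi.single_eq_of_ne hne, sub_zero]
    exact h _
  · have h1 : (0 : ℝ) ≤ if j = i + 1 then 1 else 0 := by split_ifs <;> norm_num
    have h2 : (0 : ℝ) ≤ if j = i - 1 then 1 else 0 := by split_ifs <;> norm_num
    positivity

theorem particleExp_of_stationary
    (hμ : Matrix.vecMul μ (rateMatrix (particleGenerator K N θ p)) = 0) (t : ℝ)
    (f : Config K N → ℝ) : particleExp θ p μ t f = ∑ x, μ x * f x :=
  lawExp_of_vecMul_eq_zero μ hμ t f

theorem hasDerivAt_meanDensity (a : ZMod K) (s : ℝ) :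
    HasDerivAt (fun s => meanDensity θ p μ s a) (walkAdjoint θ (meanDensity θ p μ s) a) s := by
  have h := hasDerivAt_particleExp θ p μ (lin (Pi.single a 1)) s
  rw [funext (particleGenerator_lin (N := N) θ p (Pi.single a 1)), particleExp_lin] at h
  simp only [mul_comm (walkGenerator K θ _ _), sum_mul_walkGenerator_single,
    funext (lin_single (N := N) a)] at h
  exact h

theorem sum_meanDensity (hN : N ≠ 0) (hμ : ∑ x, μ x = 1) (t : ℝ) :
    ∑ a, meanDensity θ p μ t a = 1 := by
  have h := particleExp_lin θ p μ t (fun _ => 1)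
  rw [funext (lin_const (K := K) hN 1), particleExp_const θ p μ hμ] at h
  simpa using h.symm

theorem meanDensity_nonneg (hN : 2 ≤ N) (hθ : 0 < θ) (hp : 0 < p) (hμ : ∀ x, 0 ≤ μ x) {t : ℝ}
    (ht : 0 ≤ t) (a : ZMod K) : 0 ≤ meanDensity θ p μ t a :=
  particleExp_nonneg hN hθ hp hμ ht fun _ => by positivity

omit [NeZero K] in
theorem walkAdjoint_sub_const (v : ZMod K → ℝ) (c : ℝ) (a : ZMod K) :
    walkAdjoint θ (fun b => v b - c) a = walkAdjoint θ v a := by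
  unfold walkAdjoint
  ring

omit [NeZero K] in
theorem walkAdjoint_sub (v w : ZMod K → ℝ) (a : ZMod K) :
    walkAdjoint θ (fun b => v b - w b) a = walkAdjoint θ v a - walkAdjoint θ w a := by
  unfold walkAdjoint
  ring

theorem sum_sub_inv_card {v : ZMod K → ℝ} (hv : ∑ a, v a = 1) : ∑ a, (v a - 1 / K) = 0 := by
  have hK : (K : ℝ) ≠ 0 := by exact_mod_cast NeZero.ne K
  rw [Finset.sum_sub_distrib, hv, Finset.sum_const, Finset.card_univ, ZMod.card, nsmul_eq_mul]
  field_simp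
  ring

theorem sum_sq_sub_inv_card {v : ZMod K → ℝ} (hv : ∑ a, v a = 1) :
    ∑ a, (v a - 1 / K) ^ 2 = ∑ a, v a ^ 2 - 1 / K := by
  have h : ∀ a, (v a - 1 / K) ^ 2 = v a ^ 2 - 1 / K * v a - 1 / K * (v a - 1 / K) := fun a => by
    ring
  simp only [h, Finset.sum_sub_distrib, ← Finset.mul_sum, sum_sub_inv_card hv, hv]
  ring

theorem sum_sq_le_one {v : ZMod K → ℝ} (h0 : ∀ a, 0 ≤ v a) (hv : ∑ a, v a = 1) :
    ∑ a, v a ^ 2 ≤ 1 := by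
  rw [← hv]
  refine Finset.sum_le_sum fun a _ => ?_
  have : v a ≤ 1 := hv ▸ Finset.single_le_sum (fun i _ => h0 i) (Finset.mem_univ a)
  nlinarith [h0 a]

theorem sum_sq_meanDensity_sub_le (hN : 2 ≤ N) (hθ : 0 < θ) (hp : 0 < p) (hμ : ∀ x, 0 ≤ μ x)
    (hμ1 : ∑ x, μ x = 1) {t : ℝ} (ht : 0 ≤ t) :
    ∑ a, (meanDensity θ p μ t a - 1 / K) ^ 2
      ≤ Real.exp (-(2 * rho K θ) * t) * (1 - 1 / K) := by
  have hN0 : N ≠ 0 := by omega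
  refine (sum_sq_le_exp_rho (v := fun s a => meanDensity θ p μ s a - 1 / K) hθ
    (fun a s => ?_) ?_ ht).trans ?_
  · rw [walkAdjoint_sub_const]
    exact (hasDerivAt_meanDensity a s).sub_const _
  · exact sum_sub_inv_card (sum_meanDensity hN0 hμ1 0)
  · have h1 := sum_sq_sub_inv_card (sum_meanDensity (θ := θ) (p := p) hN0 hμ1 0)
    have h2 := sum_sq_le_one (fun a => meanDensity_nonneg hN hθ hp hμ le_rfl a)
      (sum_meanDensity hN0 hμ1 0)
    rw [h1]
    gcongr

/-- The stationary profile does not move, yet its distance to uniform contracts by a factor below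
one, so this distance is zero. -/
theorem meanDensity_of_stationary (hK : 3 ≤ K) (hN : 2 ≤ N) (hθ : 0 < θ)
    (hμ1 : ∑ x, μ x = 1)
    (hst : Matrix.vecMul μ (rateMatrix (particleGenerator K N θ p)) = 0) (t : ℝ) (a : ZMod K) :
    meanDensity θ p μ t a = 1 / K := by
  have hN0 : N ≠ 0 := by omega
  have hconst : ∀ s a, meanDensity θ p μ s a = meanDensity θ p μ t a := fun s a => by
    simp only [meanDensity, particleExp_of_stationary hst]
  have h := sum_sq_le_exp_rho (v := fun s a => meanDensity θ p μ s a - 1 / K) hθ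
    (fun a s => by
      rw [walkAdjoint_sub_const]
      exact (hasDerivAt_meanDensity a s).sub_const _)
    (sum_sub_inv_card (sum_meanDensity hN0 hμ1 0)) zero_le_one
  simp only [hconst] at h
  have hlt : Real.exp (-(2 * rho K θ) * 1) < 1 := by
    rw [Real.exp_lt_one_iff]
    linarith [rho_pos hK hθ]
  have h0 : ∑ a, (meanDensity θ p μ t a - 1 / K) ^ 2 = 0 := by
    refine le_antisymm ?_ (Finset.sum_nonneg fun a _ => sq_nonneg _)
    nlinarith
  have h1 := (Finset.sum_eq_zero_iff_of_nonneg fun a _ => sq_nonneg _).mp h0 a (Finset.mem_univ a)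
  exact sub_eq_zero.mp (pow_eq_zero_iff two_ne_zero |>.mp h1)

variable (θ p μ) in
/-- The variance at time `t` of the integral of `w` against the empirical distribution. -/
noncomputable def lawVar (t : ℝ) (w : ZMod K → ℝ) : ℝ :=
  particleExp θ p μ t (fun η => lin w η ^ 2) - particleExp θ p μ t (lin w) ^ 2

/-- The rate at which the variance of the integral of `w` is created when the expected density
is `m`. -/
noncomputable def varSource (N : ℕ) (θ p : ℝ) (m w : ZMod K → ℝ) : ℝ :=
  1 / N * ∑ a, carre θ w a * m a + pN N p * (∑ a, w a ^ 2 * m a - (∑ a, w a * m a) ^ 2)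

/-- Backward transport cancels the cross term of the generator. Rewriting the second moment as
variance plus squared mean moves that square into `varSource` and leaves damping at rate `pN`. -/
theorem hasDerivAt_lawVar (hN : N ≠ 0) (w : ℝ → ZMod K → ℝ) (s : ℝ)
    (hw : ∀ a, HasDerivAt (fun s => w s a) (-walkGenerator K θ (w s) a) s) :
    HasDerivAt (fun s => lawVar θ p μ s (w s))
      (varSource N θ p (meanDensity θ p μ s) (w s) - pN N p * lawVar θ p μ s (w s)) s := by
  refine ((hasDerivAt_particleExp_lin_sq θ p μ hN w s hw).sub
    ((hasDerivAt_particleExp_lin θ p μ w s hw).pow 2)).congr_deriv ?_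
  rw [varSource, lawVar, particleExp_lin, particleExp_lin, particleExp_lin]
  ring

/-- Two laws and two test families are allowed because the lemma serves twice: to compare sites
under one stationary law, and to compare two initial laws at one site. -/
theorem hasDerivAt_exp_mul_lawVar_sub (hN : N ≠ 0) {μ' : Config K N → ℝ} (w w' : ℝ → ZMod K → ℝ)
    (s : ℝ) (hw : ∀ a, HasDerivAt (fun s => w s a) (-walkGenerator K θ (w s) a) s)
    (hw' : ∀ a, HasDerivAt (fun s => w' s a) (-walkGenerator K θ (w' s) a) s) :
    HasDerivAt (fun s => Real.exp (pN N p * s) * (lawVar θ p μ s (w s) - lawVar θ p μ' s (w' s)))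
      (Real.exp (pN N p * s) * (varSource N θ p (meanDensity θ p μ s) (w s)
        - varSource N θ p (meanDensity θ p μ' s) (w' s))) s := by
  have h1 : HasDerivAt (fun s => pN N p * s) (pN N p) s := by
    simpa using (hasDerivAt_id s).const_mul (pN N p)
  refine (h1.exp.mul ((hasDerivAt_lawVar hN w s hw).sub
    (hasDerivAt_lawVar hN w' s hw'))).congr_deriv ?_
  simp only [Pi.sub_apply]
  ring

theorem sq_sum_mul_le {w : ZMod K → ℝ} (h0 : ∀ a, 0 ≤ w a) (h1 : ∑ a, w a = 1) (y : ZMod K → ℝ) :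
    (∑ a, w a * y a) ^ 2 ≤ ∑ a, w a * y a ^ 2 := by
  have := (even_two.convexOn_pow (𝕜 := ℝ)).map_sum_le (t := Finset.univ) (w := w) (p := y)
    (fun a _ => h0 a) h1 (fun a _ => Set.mem_univ _)
  simpa using this

theorem lawVar_eq_of_stationary (hμ1 : ∑ x, μ x = 1)
    (hst : Matrix.vecMul μ (rateMatrix (particleGenerator K N θ p)) = 0) (t : ℝ)
    (w : ZMod K → ℝ) :
    lawVar θ p μ t w = ∑ x, μ x * (lin w x - particleExp θ p μ t (lin w)) ^ 2 := by
  have h : ∀ x, μ x * (lin w x - particleExp θ p μ t (lin w)) ^ 2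
      = μ x * lin w x ^ 2 - 2 * particleExp θ p μ t (lin w) * (μ x * lin w x)
        + particleExp θ p μ t (lin w) ^ 2 * μ x := fun x => by ring
  simp only [h, Finset.sum_add_distrib, Finset.sum_sub_distrib, ← Finset.mul_sum, hμ1,
    ← particleExp_of_stationary hst t]
  rw [lawVar]
  ring

section Stationary

variable (hK : 3 ≤ K) (hN : 2 ≤ N) (hθ : 0 < θ) (hp : 0 < p)
  {ν : Config K N → ℝ} (hν : ∀ x, 0 ≤ ν x) (hν1 : ∑ x, ν x = 1)
  (hst : Matrix.vecMul ν (rateMatrix (particleGenerator K N θ p)) = 0)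

include hst

theorem lawVar_stationary_time (s t : ℝ) (w : ZMod K → ℝ) :
    lawVar θ p ν s w = lawVar θ p ν t w := by
  simp only [lawVar, particleExp_of_stationary hst]

include hν hν1

theorem lawVar_stationary_nonneg (t : ℝ) (w : ZMod K → ℝ) : 0 ≤ lawVar θ p ν t w := by
  rw [lawVar_eq_of_stationary hν1 hst]
  exact Finset.sum_nonneg fun x _ => mul_nonneg (hν x) (sq_nonneg _)

include hN in
theorem lawVar_stationary_le_one (t : ℝ) {w : ZMod K → ℝ} (h0 : ∀ a, 0 ≤ w a)
    (h1 : ∑ a, w a = 1) : lawVar θ p ν t w ≤ 1 := by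
  have hw1 : ∀ a, w a ≤ 1 := fun a =>
    h1 ▸ Finset.single_le_sum (fun i _ => h0 i) (Finset.mem_univ a)
  have hlin : ∀ x : Config K N, 0 ≤ lin w x ∧ lin w x ≤ 1 := by
    intro x
    refine ⟨Finset.sum_nonneg fun a _ => mul_nonneg (h0 a) (by positivity), ?_⟩
    rw [← sum_density (by omega) x]
    refine Finset.sum_le_sum fun a _ => mul_le_of_le_one_left (by positivity) (hw1 a)
  have h2 : particleExp θ p ν t (fun η => lin w η ^ 2) ≤ 1 := by
    rw [particleExp_of_stationary hst, ← hν1]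
    refine Finset.sum_le_sum fun x _ => mul_le_of_le_one_right (hν x) ?_
    exact pow_le_one₀ (hlin x).1 (hlin x).2
  unfold lawVar
  linarith [sq_nonneg (particleExp θ p ν t (lin w))]

include hK hN hθ

/-- Jensen for the weights `w`: all sites share the mean 1/K, so the centred functional is the
average of the centred site proportions. -/
theorem lawVar_stationary_le (t : ℝ) {w : ZMod K → ℝ} (h0 : ∀ a, 0 ≤ w a) (h1 : ∑ a, w a = 1) :
    lawVar θ p ν t w ≤ ∑ a, w a * lawVar θ p ν t (Pi.single a 1) := by
  have hmean : ∀ w' : ZMod K → ℝ, ∑ a, w' a = 1 → particleExp θ p ν t (lin w') = 1 / K := by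
    intro w' hw'
    rw [particleExp_lin]
    simp only [meanDensity_of_stationary hK hN hθ hν1 hst, ← Finset.sum_mul, hw', one_mul]
  simp only [lawVar_eq_of_stationary hν1 hst, Finset.mul_sum]
  rw [Finset.sum_comm]
  refine Finset.sum_le_sum fun x _ => ?_
  have h2 : ∀ a, w a * (ν x * (lin (Pi.single a 1) x
      - particleExp θ p ν t (lin (Pi.single a 1))) ^ 2)
      = ν x * (w a * ((x.1 a : ℝ) / N - 1 / K) ^ 2) := by
    intro a
    rw [hmean _ (by simp), lin_single]
    ring
  simp only [h2, ← Finset.mul_sum]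
  refine mul_le_mul_of_nonneg_left ?_ (hν x)
  refine le_trans (le_of_eq ?_) (sq_sum_mul_le h0 h1 _)
  rw [hmean w h1]
  simp only [mul_sub, Finset.sum_sub_distrib, ← Finset.sum_mul, h1, one_mul]
  rfl

include hp in
/-- Under a stationary distribution all sites have the same occupation variance. -/
theorem lawVar_stationary_single (t : ℝ) (c : ZMod K) :
    lawVar θ p ν t (Pi.single c 1) = lawVar θ p ν t (Pi.single 0 1) := by
  have hN0 : N ≠ 0 := by omega
  have hpN := pN_pos hN hp
  -- Run the variance equation over [0, T] with test functions ending at the indicators of c and 0.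
  -- They are translates of each other and the profile is uniform, so the sources agree and the
  -- weighted difference equals its initial value, at most 1. Uniqueness of the stationary law is
  -- not needed.
  have key : ∀ T : ℝ, 0 ≤ T → Real.exp (pN N p * T) *
      |lawVar θ p ν t (Pi.single c 1) - lawVar θ p ν t (Pi.single 0 1)| ≤ 1 := by
    intro T hT
    set w : ZMod K → ℝ → ZMod K → ℝ := fun k s a => walkTransition θ (T - s) a k with hw
    have hd := fun s => hasDerivAt_exp_mul_lawVar_sub (p := p) hN0 (μ := ν) (μ' := ν) (w c) (w 0) s
      (fun a => hasDerivAt_walkTransition_sub θ T s a c)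
      (fun a => hasDerivAt_walkTransition_sub θ T s a 0)
    have hshift : ∀ s a, w c s (a + c) = w 0 s a := by
      intro s a
      have := walkTransition_add_right θ (T - s) a 0 c
      rwa [zero_add] at this
    have hsrc : ∀ s, varSource N θ p (meanDensity θ p ν s) (w c s)
        = varSource N θ p (meanDensity θ p ν s) (w 0 s) := by
      intro s
      have hsum : ∀ f g : ZMod K → ℝ, (∀ a, f (a + c) = g a) → ∑ a, f a = ∑ a, g a := by
        intro f g hfg
        rw [← Equiv.sum_comp (Equiv.addRight c) f]
        exact Finset.sum_congr rfl fun a _ => hfg a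
      have hm := meanDensity_of_stationary hK hN hθ hν1 hst s
      have e1 : ∑ a, carre θ (w c s) a * meanDensity θ p ν s a
          = ∑ a, carre θ (w 0 s) a * meanDensity θ p ν s a := by
        refine hsum _ _ fun a => ?_
        rw [hm, hm, carre, carre, add_right_comm a c 1, ← sub_add_eq_add_sub, hshift, hshift,
          hshift]
      have e2 : ∑ a, w c s a ^ 2 * meanDensity θ p ν s a
          = ∑ a, w 0 s a ^ 2 * meanDensity θ p ν s a :=
        hsum _ _ fun a => by rw [hm, hm, hshift]
      have e3 : ∑ a, w c s a * meanDensity θ p ν s a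
          = ∑ a, w 0 s a * meanDensity θ p ν s a :=
        hsum _ _ fun a => by rw [hm, hm, hshift]
      rw [varSource, varSource, e1, e2, e3]
    have hconst := is_const_of_deriv_eq_zero (fun s => (hd s).differentiableAt)
      (fun s => by rw [(hd s).deriv, hsrc, sub_self, mul_zero]) T 0
    have hwT : ∀ k, w k T = Pi.single k 1 := by
      intro k
      simp only [hw, sub_self]
      exact walkTransition_zero θ k
    simp only [hwT, mul_zero, Real.exp_zero, one_mul] at hconst
    rw [lawVar_stationary_time hst T t, lawVar_stationary_time hst T t] at hconst
    have habs := congrArg abs hconst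
    rw [abs_mul, abs_of_pos (Real.exp_pos _)] at habs
    rw [habs]
    have hw0 : ∀ k a, 0 ≤ w k 0 a := fun k a => walkTransition_nonneg hθ (by simpa using hT) a k
    have hw1 : ∀ k, ∑ a, w k 0 a = 1 := fun k => sum_walkTransition θ _ k
    have a1 := lawVar_stationary_le_one hN hν hν1 hst 0 (hw0 c) (hw1 c)
    have a2 := lawVar_stationary_le_one hN hν hν1 hst 0 (hw0 0) (hw1 0)
    have a3 := lawVar_stationary_nonneg hν hν1 hst 0 (w c 0)
    have a4 := lawVar_stationary_nonneg hν hν1 hst 0 (w 0 0)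
    rw [abs_le]
    constructor <;> linarith
  by_contra hne
  have hpos := abs_pos.mpr (sub_ne_zero.mpr hne)
  set d := |lawVar θ p ν t (Pi.single c 1) - lawVar θ p ν t (Pi.single 0 1)|
  -- With this T, e^{`pN` T} d ≥ (1 + `pN` T) d = d + 1 > 1.
  have h1 := key (1 / (pN N p * d)) (by positivity)
  have h2 := Real.add_one_le_exp (pN N p * (1 / (pN N p * d)))
  have h3 : pN N p * (1 / (pN N p * d)) * d = 1 := by
    field_simp
  nlinarith

end Stationary

end Variance

end FlemingViot

/-! ### Comparison of the variances from η and from the stationary law. -/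

namespace FlemingViot

section Comparison

/-- The quotient is a Duhamel integral: times e^{as}, it is the primitive of e^{(a-b)s} vanishing at
0, also when a = b. -/
theorem hasDerivAt_exp_mul_expQuotient (a b s : ℝ) :
    HasDerivAt (fun s => Real.exp (a * s) * expQuotient a b s) (Real.exp ((a - b) * s)) s := by
  rcases eq_or_ne a b with rfl | hab
  · have h : (fun s => Real.exp (a * s) * expQuotient a a s) = fun s => s := by
      funext s
      rw [expQuotient, if_pos rfl, mul_left_comm, ← Real.exp_add]
      simp
    rw [h]
    exact (hasDerivAt_id' s).congr_deriv (by simp)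
  · have hba : b - a ≠ 0 := sub_ne_zero.mpr hab.symm
    have h : (fun s => Real.exp (a * s) * expQuotient a b s)
        = fun s => (1 - Real.exp ((a - b) * s)) / (b - a) := by
      funext s
      rw [expQuotient, if_neg hab, ← mul_div_assoc, mul_sub, ← Real.exp_add, ← Real.exp_add]
      congr 2
      · simp
      · congr 1
        ring
    rw [h]
    have h1 : HasDerivAt (fun s => (a - b) * s) (a - b) s := by
      simpa using (hasDerivAt_id s).const_mul (a - b)
    refine ((h1.exp.const_sub 1).div_const (b - a)).congr_deriv ?_
    rw [div_eq_iff hba]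
    ring

theorem expQuotient_zero (a b : ℝ) : expQuotient a b 0 = 0 := by
  unfold expQuotient
  split_ifs <;> simp

variable {K : ℕ} [NeZero K] {N : ℕ} {θ p : ℝ}

/-- For nonnegative x and y, (x - y)² ≤ x² + y², which saves a factor 2. -/
theorem sum_carre_le (hθ : 0 < θ) {w : ZMod K → ℝ} (h0 : ∀ a, 0 ≤ w a) (h1 : ∑ a, w a = 1) :
    ∑ a, carre θ w a ≤ 2 * (1 + θ) := by
  have hsq := sum_sq_le_one h0 h1
  have e1 : ∑ a, w (a + 1) ^ 2 = ∑ a, w a ^ 2 := sum_add_one fun a => w a ^ 2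
  have e2 : ∑ a, w (a - 1) ^ 2 = ∑ a, w a ^ 2 := sum_sub_one fun a => w a ^ 2
  calc ∑ a, carre θ w a
      ≤ ∑ a, ((w (a + 1) ^ 2 + w a ^ 2) + θ * (w (a - 1) ^ 2 + w a ^ 2)) := by
        refine Finset.sum_le_sum fun a _ => ?_
        unfold carre
        have i1 := mul_nonneg (h0 (a + 1)) (h0 a)
        have i2 := mul_nonneg (h0 (a - 1)) (h0 a)
        gcongr
        · nlinarith
        · nlinarith
    _ = 2 * (1 + θ) * ∑ a, w a ^ 2 := by
        simp only [Finset.sum_add_distrib, ← Finset.mul_sum, e1, e2]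
        ring
    _ ≤ 2 * (1 + θ) := mul_le_of_le_one_right (by linarith) hsq

theorem abs_sum_mul_le {f g : ZMod K → ℝ} {b c : ℝ} (hb : 0 ≤ b) (hg : ∀ a, |g a| ≤ b)
    (hf : ∑ a, |f a| ≤ c) : |∑ a, f a * g a| ≤ c * b :=
  calc |∑ a, f a * g a| ≤ ∑ a, |f a * g a| := Finset.abs_sum_le_sum_abs _ _
    _ ≤ ∑ a, |f a| * b := Finset.sum_le_sum fun a _ => by
        rw [abs_mul]
        exact mul_le_mul_of_nonneg_left (hg a) (abs_nonneg _)
    _ = (∑ a, |f a|) * b := by rw [Finset.sum_mul]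
    _ ≤ c * b := by gcongr

/-- The variance source at a density close to uniform is close to the one at the uniform
density. -/
theorem abs_varSource_sub_le (hN : 2 ≤ N) (hθ : 0 < θ) (hp : 0 < p) {m w : ZMod K → ℝ} {b : ℝ}
    (hm0 : ∀ a, 0 ≤ m a) (hm1 : ∑ a, m a = 1) (h0 : ∀ a, 0 ≤ w a) (h1 : ∑ a, w a = 1)
    (hb : ∀ a, |m a - 1 / K| ≤ b) :
    |varSource N θ p m w - varSource N θ p (fun _ => 1 / (K : ℝ)) w|
      ≤ (2 * (1 + θ) / N + pN N p * (((K : ℝ) + 1) / K)) * b := by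
  have hb0 : 0 ≤ b := (abs_nonneg _).trans (hb 0)
  have hK : (0 : ℝ) < K := by exact_mod_cast Nat.pos_of_ne_zero (NeZero.ne K)
  have hpN := pN_pos hN hp
  have hw1 : ∀ a, w a ≤ 1 := fun a =>
    h1 ▸ Finset.single_le_sum (fun i _ => h0 i) (Finset.mem_univ a)
  -- The sum factor in the difference of squares (∑ w m)² - (1/K)²; the other factor is ∑ w (m -
  -- 1/K).
  set c : ℝ := ∑ a, w a * m a + 1 / K with hc
  have hwm0 : 0 ≤ ∑ a, w a * m a := Finset.sum_nonneg fun a _ => mul_nonneg (h0 a) (hm0 a)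
  have hwm1 : ∑ a, w a * m a ≤ 1 := by
    rw [← hm1]
    exact Finset.sum_le_sum fun a _ => mul_le_of_le_one_left (hm0 a) (hw1 a)
  have hKi : 0 < 1 / (K : ℝ) := by positivity
  have hsplit : varSource N θ p m w - varSource N θ p (fun _ => 1 / (K : ℝ)) w
      = 1 / N * ∑ a, carre θ w a * (m a - 1 / K)
        + pN N p * ∑ a, (w a * (w a - c)) * (m a - 1 / K) := by
    have e1 : ∑ a, carre θ w a * (m a - 1 / K)
        = ∑ a, carre θ w a * m a - ∑ a, carre θ w a * (1 / (K : ℝ)) := by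
      rw [← Finset.sum_sub_distrib]
      exact Finset.sum_congr rfl fun a _ => by ring
    have e2 : ∑ a, (w a * (w a - c)) * (m a - 1 / K)
        = ∑ a, w a ^ 2 * m a - ∑ a, w a ^ 2 * (1 / (K : ℝ)) - c * ∑ a, w a * m a
          + c * ∑ a, w a * (1 / (K : ℝ)) := by
      rw [Finset.mul_sum, Finset.mul_sum, ← Finset.sum_sub_distrib, ← Finset.sum_sub_distrib,
        ← Finset.sum_add_distrib]
      exact Finset.sum_congr rfl fun a _ => by ring
    have e3 : ∑ a, w a * (1 / (K : ℝ)) = 1 / K := by rw [← Finset.sum_mul, h1, one_mul]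
    rw [varSource, varSource, e1, e2, e3, hc]
    ring
  rw [hsplit, add_mul]
  refine (abs_add_le _ _).trans (add_le_add ?_ ?_)
  · rw [abs_mul, abs_of_nonneg (by positivity : (0 : ℝ) ≤ 1 / N)]
    have := abs_sum_mul_le (f := carre θ w) (c := 2 * (1 + θ)) hb0 hb (by
      refine le_of_eq_of_le (Finset.sum_congr rfl fun a _ => abs_of_nonneg ?_)
        (sum_carre_le hθ h0 h1)
      unfold carre
      positivity)
    calc _ ≤ 1 / (N : ℝ) * (2 * (1 + θ) * b) := by gcongr
      _ = _ := by ring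
  · rw [abs_mul, abs_of_pos hpN, mul_assoc]
    refine mul_le_mul_of_nonneg_left (abs_sum_mul_le hb0 hb ?_) hpN.le
    calc ∑ a, |w a * (w a - c)| ≤ ∑ a, w a * (((K : ℝ) + 1) / K) := by
          refine Finset.sum_le_sum fun a _ => ?_
          rw [abs_mul, abs_of_nonneg (h0 a)]
          refine mul_le_mul_of_nonneg_left ?_ (h0 a)
          have : ((K : ℝ) + 1) / K = 1 + 1 / K := by field_simp
          rw [this, abs_le]
          have := h0 a
          have := hw1 a
          constructor <;> linarith
      _ = ((K : ℝ) + 1) / K := by rw [← Finset.sum_mul, h1, one_mul]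

-- The constant C_{K,N} has slack: the square root is dropped from the walk term, and the summand
-- p/(N-1) is extra.
omit [NeZero K] in
theorem constC_ge (hK : 3 ≤ K) (hN : 2 ≤ N) (hθ : 0 < θ) (hp : 0 < p) :
    (2 * (1 + θ) / N + pN N p * (((K : ℝ) + 1) / K)) * √(1 - 1 / (K : ℝ)) ≤ constC K N θ p := by
  have hK' : (3 : ℝ) ≤ K := by exact_mod_cast hK
  have hN' : (2 : ℝ) ≤ N := by exact_mod_cast hN
  have hN1 : (0 : ℝ) < N - 1 := by linarith
  have hK0 : (0 : ℝ) < K := by linarith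
  have hs : √(1 - 1 / (K : ℝ)) = √((K : ℝ) - 1) / √(K : ℝ) := by
    rw [← Real.sqrt_div (by linarith), sub_div, div_self hK0.ne']
  have hs1 : √(1 - 1 / (K : ℝ)) ≤ 1 := by
    have : 0 < 1 / (K : ℝ) := by positivity
    exact Real.sqrt_le_one.mpr (by linarith)
  have hsK : 0 < √(K : ℝ) := Real.sqrt_pos.mpr hK0
  have e1 : 2 * (1 + θ) / N * √(1 - 1 / (K : ℝ)) ≤ 2 * (1 + θ) / N :=
    mul_le_of_le_one_right (by positivity) hs1
  have e2 : pN N p * (((K : ℝ) + 1) / K) * √(1 - 1 / (K : ℝ))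
      = 2 / N * (p * N * ((K : ℝ) + 1) * √((K : ℝ) - 1) / (K * √(K : ℝ) * ((N : ℝ) - 1))) := by
    rw [hs, pN]
    field_simp
  have e3 : 0 ≤ 2 / (N : ℝ) * (p / ((N : ℝ) - 1)) := by positivity
  rw [add_mul, e2, constC]
  calc _ ≤ 2 * (1 + θ) / N + 2 / N * (p * N * ((K : ℝ) + 1) * √((K : ℝ) - 1)
        / (K * √(K : ℝ) * ((N : ℝ) - 1))) + 2 / (N : ℝ) * (p / ((N : ℝ) - 1)) := by linarith
    _ = _ := by ring

theorem lawVar_single_init (η : Config K N) (w : ZMod K → ℝ) :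
    lawVar θ p (Pi.single η 1) 0 w = 0 := by
  simp [lawVar, particleExp, lawExp_zero, Pi.single_apply]

theorem abs_lawVar_sub_le (hK : 3 ≤ K) (hN : 2 ≤ N) (hθ : 0 < θ) (hp : 0 < p) (η : Config K N)
    {ν : Config K N → ℝ} (hν : ∀ x, 0 ≤ ν x) (hν1 : ∑ x, ν x = 1)
    (hst : Matrix.vecMul ν (rateMatrix (particleGenerator K N θ p)) = 0) (k : ZMod K) {t : ℝ}
    (ht : 0 ≤ t) :
    |lawVar θ p (Pi.single η 1) t (Pi.single k 1) - lawVar θ p ν t (Pi.single k 1)|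
      ≤ constC K N θ p * expQuotient (pN N p) (rho K θ) t
        + Real.exp (-pN N p * t) * lawVar θ p ν 0 (Pi.single 0 1) := by
  have hN0 : N ≠ 0 := by omega
  set μ : Config K N → ℝ := Pi.single η 1 with hμdef
  have hμ : ∀ x, 0 ≤ μ x := fun x => by
    rw [hμdef, Pi.single_apply]; split_ifs <;> norm_num
  have hμ1 : ∑ x, μ x = 1 := by simp [hμdef]
  set w : ℝ → ZMod K → ℝ := fun s a => walkTransition θ (t - s) a k with hw
  have hd := fun s => hasDerivAt_exp_mul_lawVar_sub (p := p) hN0 (μ := μ) (μ' := ν) w w s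
    (fun a => hasDerivAt_walkTransition_sub θ t s a k)
    (fun a => hasDerivAt_walkTransition_sub θ t s a k)
  have hw0 : ∀ s, s ≤ t → ∀ a, 0 ≤ w s a := fun s hs a =>
    walkTransition_nonneg hθ (by linarith) a k
  have hw1 : ∀ s, ∑ a, w s a = 1 := fun s => sum_walkTransition θ _ k
  -- Comparison function: it starts at a bound for the initial gap, and its derivative dominates
  -- that of the weighted difference.
  have hB : ∀ s, HasDerivAt (fun s => lawVar θ p ν 0 (Pi.single 0 1)
      + constC K N θ p * (Real.exp (pN N p * s) * expQuotient (pN N p) (rho K θ) s))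
      (constC K N θ p * Real.exp ((pN N p - rho K θ) * s)) s := fun s =>
    ((hasDerivAt_exp_mul_expQuotient _ _ s).const_mul _).const_add _
  -- A deterministic start has no variance, so only the stationary variance of `w 0` remains.
  have hinit : ‖Real.exp (pN N p * 0) * (lawVar θ p μ 0 (w 0) - lawVar θ p ν 0 (w 0))‖
      ≤ lawVar θ p ν 0 (Pi.single 0 1)
        + constC K N θ p * (Real.exp (pN N p * 0) * expQuotient (pN N p) (rho K θ) 0) := by
    rw [expQuotient_zero, hμdef, lawVar_single_init, mul_zero, Real.exp_zero, mul_zero, mul_zero,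
      add_zero, one_mul, zero_sub, norm_neg, Real.norm_of_nonneg
        (lawVar_stationary_nonneg hν hν1 hst 0 _)]
    refine (lawVar_stationary_le hK hN hθ hν hν1 hst 0 (hw0 0 ht) (hw1 0)).trans (le_of_eq ?_)
    simp only [lawVar_stationary_single hK hN hθ hp hν hν1 hst 0, ← Finset.sum_mul, hw1, one_mul]
  have hbound : ∀ s ∈ Set.Ico 0 t, ‖Real.exp (pN N p * s)
      * (varSource N θ p (meanDensity θ p μ s) (w s)
        - varSource N θ p (meanDensity θ p ν s) (w s))‖
      ≤ constC K N θ p * Real.exp ((pN N p - rho K θ) * s) := by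
    intro s hs
    have hmν : meanDensity θ p ν s = fun _ => 1 / (K : ℝ) := by
      funext a
      exact meanDensity_of_stationary hK hN hθ hν1 hst s a
    have hdev : ∀ a, |meanDensity θ p μ s a - 1 / K|
        ≤ √(1 - 1 / (K : ℝ)) * Real.exp (-rho K θ * s) := by
      intro a
      have h1 := sum_sq_meanDensity_sub_le hN hθ hp hμ hμ1 hs.1
      have h2 := Finset.single_le_sum (f := fun a => (meanDensity θ p μ s a - 1 / (K : ℝ)) ^ 2)
        (fun i _ => sq_nonneg _) (Finset.mem_univ a)
      have h3 : Real.exp (-(2 * rho K θ) * s) = Real.exp (-rho K θ * s) ^ 2 := by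
        rw [← Real.exp_nat_mul]
        congr 1
        push_cast
        ring
      rw [h3] at h1
      refine (Real.abs_le_sqrt (h2.trans h1)).trans (le_of_eq ?_)
      rw [Real.sqrt_mul (sq_nonneg _), Real.sqrt_sq (Real.exp_pos _).le, mul_comm]
    have h4 := abs_varSource_sub_le hN hθ hp (fun a => meanDensity_nonneg hN hθ hp hμ hs.1 a)
      (sum_meanDensity hN0 hμ1 s) (hw0 s hs.2.le) (hw1 s) hdev
    rw [hmν, norm_mul, Real.norm_of_nonneg (Real.exp_pos _).le, Real.norm_eq_abs]
    calc _ ≤ Real.exp (pN N p * s) * ((2 * (1 + θ) / N + pN N p * (((K : ℝ) + 1) / K))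
          * (√(1 - 1 / (K : ℝ)) * Real.exp (-rho K θ * s))) := by gcongr
      _ = ((2 * (1 + θ) / N + pN N p * (((K : ℝ) + 1) / K)) * √(1 - 1 / (K : ℝ)))
          * Real.exp ((pN N p - rho K θ) * s) := by
          rw [show (pN N p - rho K θ) * s = pN N p * s + -rho K θ * s by ring, Real.exp_add]
          ring
      _ ≤ _ := by
          have := constC_ge hK hN hθ hp
          gcongr
  have hfin := image_norm_le_of_norm_deriv_right_le_deriv_boundary
    (fun s _ => (hd s).continuousAt.continuousWithinAt) (fun s _ => (hd s).hasDerivWithinAt)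
    hinit hB hbound (Set.right_mem_Icc.mpr ht)
  have hwt : w t = Pi.single k 1 := by
    simp only [hw, sub_self]
    exact walkTransition_zero θ k
  rw [hwt, norm_mul, Real.norm_of_nonneg (Real.exp_pos _).le, Real.norm_eq_abs] at hfin
  have he : Real.exp (-pN N p * t) * Real.exp (pN N p * t) = 1 := by
    rw [← Real.exp_add]
    simp
  have := mul_le_mul_of_nonneg_left hfin (Real.exp_pos (-pN N p * t)).le
  rw [← mul_assoc, he, one_mul] at this
  refine this.trans (le_of_eq ?_)
  linear_combination (constC K N θ p * expQuotient (pN N p) (rho K θ) t) * he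

end Comparison

end FlemingViot

/-! ### Uniform bound on the total variance. -/

namespace FlemingViot

section TotalVariance

variable {K : ℕ} [NeZero K] {N : ℕ} {θ p : ℝ} {μ : Config K N → ℝ}

theorem lin_sub (v w : ZMod K → ℝ) (η : Config K N) : lin (v - w) η = lin v η - lin w η := by
  simp only [lin, Pi.sub_apply, sub_mul, Finset.sum_sub_distrib]

theorem particleExp_sq_sub (hμ1 : ∑ x, μ x = 1) (t : ℝ) (f : Config K N → ℝ) :
    particleExp θ p μ t (fun η => (f η - particleExp θ p μ t f) ^ 2)
      = particleExp θ p μ t (fun η => f η ^ 2) - particleExp θ p μ t f ^ 2 := by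
  have h : (fun η => (f η - particleExp θ p μ t f) ^ 2)
      = fun η => (f η ^ 2 - (2 * particleExp θ p μ t f) * f η) + particleExp θ p μ t f ^ 2 := by
    funext η
    ring
  conv_lhs => rw [h]
  rw [particleExp, lawExp_add, lawExp_sub, lawExp_const_mul]
  have hc := particleExp_const θ p μ hμ1 t (particleExp θ p μ t f ^ 2)
  unfold particleExp at hc ⊢
  rw [hc]
  ring

theorem particleExp_le_sqrt (hN : 2 ≤ N) (hθ : 0 < θ) (hp : 0 < p) (hμ : ∀ x, 0 ≤ μ x)
    (hμ1 : ∑ x, μ x = 1) {t : ℝ} (ht : 0 ≤ t) (f : Config K N → ℝ) :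
    particleExp θ p μ t f ≤ √(particleExp θ p μ t (fun η => f η ^ 2)) := by
  apply Real.le_sqrt_of_sq_le
  have h := particleExp_nonneg hN hθ hp hμ ht (f := fun η => (f η - particleExp θ p μ t f) ^ 2)
    fun η => sq_nonneg _
  rw [particleExp_sq_sub hμ1] at h
  linarith

theorem particleExp_mono (hN : 2 ≤ N) (hθ : 0 < θ) (hp : 0 < p) (hμ : ∀ x, 0 ≤ μ x) {t : ℝ}
    (ht : 0 ≤ t) {f g : Config K N → ℝ} (hfg : ∀ η, f η ≤ g η) :
    particleExp θ p μ t f ≤ particleExp θ p μ t g := by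
  have h := particleExp_nonneg hN hθ hp hμ ht (f := fun η => g η - f η)
    fun η => sub_nonneg.mpr (hfg η)
  rw [particleExp, lawExp_sub] at h
  exact sub_nonneg.mp h

theorem sum_lawVar_single (hμ1 : ∑ x, μ x = 1) (t : ℝ) :
    ∑ k, lawVar θ p μ t (Pi.single k 1)
      = particleExp θ p μ t (fun η => ∑ k, ((η.1 k : ℝ) / N - meanDensity θ p μ t k) ^ 2) := by
  rw [particleExp, lawExp_sum]
  refine Finset.sum_congr rfl fun k _ => ?_
  rw [lawVar, funext (lin_single (N := N) k), ← particleExp_sq_sub hμ1]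
  rfl

/-- The spectral gap inequality for the fluctuations of the empirical distribution. -/
theorem rho_mul_sum_lawVar_le (hN : 2 ≤ N) (hθ : 0 < θ) (hp : 0 < p) (hμ : ∀ x, 0 ≤ μ x)
    (hμ1 : ∑ x, μ x = 1) {t : ℝ} (ht : 0 ≤ t) :
    2 * rho K θ * ∑ k, lawVar θ p μ t (Pi.single k 1)
      ≤ (1 + θ) * ∑ k, lawVar θ p μ t (Pi.single (k + 1) 1 - Pi.single k 1) := by
  have hN0 : N ≠ 0 := by omega
  have h1 : ∑ k : ZMod K, lawVar θ p μ t (Pi.single (k + 1) 1 - Pi.single k 1)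
      = particleExp θ p μ t (fun η => ∑ k, (((η.1 (k + 1) : ℝ) / N - meanDensity θ p μ t (k + 1))
        - ((η.1 k : ℝ) / N - meanDensity θ p μ t k)) ^ 2) := by
    unfold particleExp
    rw [lawExp_sum]
    refine Finset.sum_congr rfl fun k _ => ?_
    rw [lawVar, ← particleExp_sq_sub hμ1]
    have hmean : particleExp θ p μ t (lin (Pi.single (k + 1) 1 - Pi.single k 1))
        = meanDensity θ p μ t (k + 1) - meanDensity θ p μ t k := by
      simp [particleExp_lin, sub_mul, Finset.sum_sub_distrib, Pi.single_apply]
    rw [hmean]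
    unfold particleExp
    congr 1
    funext η
    rw [lin_sub, lin_single, lin_single]
    ring
  rw [h1, sum_lawVar_single hμ1]
  unfold particleExp
  rw [← lawExp_const_mul, ← lawExp_const_mul]
  -- For each configuration the fluctuation vector sums to zero, so Poincaré applies pointwise
  -- before averaging.
  refine particleExp_mono hN hθ hp hμ ht fun η => rho_le_dirichlet hθ
    (fun k => (η.1 k : ℝ) / N - meanDensity θ p μ t k) ?_
  rw [Finset.sum_sub_distrib, sum_density hN0, sum_meanDensity hN0 hμ1, sub_self]

/-- Each jump changes exactly two site indicators by one. -/
theorem sum_carre_single (hK : 3 ≤ K) (a : ZMod K) :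
    ∑ k, carre θ (Pi.single k 1) a = 2 * (1 + θ) := by
  have : Fact (1 < K) := ⟨by omega⟩
  have h1 : a + 1 ≠ a := by simp
  have h2 : a - 1 ≠ a := by simp
  have h : ∀ k, carre θ (Pi.single k 1) a
      = (if a + 1 = k then 1 else 0) + (if a = k then 1 else 0)
        + θ * ((if a - 1 = k then 1 else 0) + (if a = k then 1 else 0)) := by
    intro k
    simp only [carre, Pi.single_apply]
    by_cases e1 : a = k
    · subst e1
      simp [h1, h2]
    · by_cases e2 : a + 1 = k <;> by_cases e3 : a - 1 = k <;> simp [e1, e2, e3]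
  simp only [h, Finset.sum_add_distrib, ← Finset.mul_sum, Finset.sum_ite_eq, Finset.mem_univ,
    if_true]
  ring

/-- Here the test function is fixed, so the transport terms survive; summed over sites they form the
Dirichlet form of `sum_lawVar_diff`. -/
theorem hasDerivAt_lawVar_single (hN : N ≠ 0) (k : ZMod K) (s : ℝ) :
    HasDerivAt (fun s => lawVar θ p μ s (Pi.single k 1))
      (2 * particleExp θ p μ s (fun η => (η.1 k : ℝ) / N
          * walkAdjoint θ (fun a => (η.1 a : ℝ) / N) k)
        - 2 * (meanDensity θ p μ s k * walkAdjoint θ (meanDensity θ p μ s) k)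
        + (1 / N * particleExp θ p μ s (lin (carre θ (Pi.single k 1)))
        + pN N p * (meanDensity θ p μ s k
          - particleExp θ p μ s (fun η => ((η.1 k : ℝ) / N) ^ 2)))) s := by
  have hfun : (fun s => lawVar θ p μ s (Pi.single k 1))
      = fun s => particleExp θ p μ s (fun η => lin (Pi.single k 1) η ^ 2)
        - meanDensity θ p μ s k ^ 2 := by
    funext s
    rw [lawVar, meanDensity, funext (lin_single (N := N) k)]
  rw [hfun]
  refine ((hasDerivAt_particleExp θ p μ (fun η => lin (Pi.single k 1) η ^ 2) s).sub
    ((hasDerivAt_meanDensity k s).pow 2)).congr_deriv ?_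
  have hgen : particleGenerator K N θ p (fun η => lin (Pi.single k 1) η ^ 2)
      = fun η => (2 * ((η.1 k : ℝ) / N * walkAdjoint θ (fun a => (η.1 a : ℝ) / N) k)
        + 1 / N * lin (carre θ (Pi.single k 1)) η)
        + pN N p * ((η.1 k : ℝ) / N - ((η.1 k : ℝ) / N) ^ 2) := by
    funext η
    have hsq : (fun a => (Pi.single k 1 : ZMod K → ℝ) a ^ 2) = Pi.single k 1 := by
      funext a
      rw [Pi.single_apply]
      split_ifs <;> norm_num
    have hadj : lin (walkGenerator K θ (Pi.single k 1)) η
        = walkAdjoint θ (fun a => (η.1 a : ℝ) / N) k := by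
      rw [← sum_mul_walkGenerator_single]
      exact Finset.sum_congr rfl fun a _ => mul_comm _ _
    rw [particleGenerator_lin_sq θ p _ η hN, hsq, hadj, lin_single]
    ring
  rw [hgen, meanDensity]
  unfold particleExp
  rw [lawExp_add, lawExp_add, lawExp_const_mul, lawExp_const_mul, lawExp_const_mul, lawExp_sub]
  push_cast
  ring

theorem sum_lawVar_diff (s : ℝ) :
    (1 + θ) * ∑ k, lawVar θ p μ s (Pi.single (k + 1) 1 - Pi.single k 1)
      = -(2 * particleExp θ p μ s (fun η => ∑ k, (η.1 k : ℝ) / N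
          * walkAdjoint θ (fun a => (η.1 a : ℝ) / N) k))
        + 2 * ∑ k, meanDensity θ p μ s k * walkAdjoint θ (meanDensity θ p μ s) k := by
  have h1 : particleExp θ p μ s (fun η => (1 + θ) * ∑ k : ZMod K,
      ((η.1 (k + 1) : ℝ) / N - (η.1 k : ℝ) / N) ^ 2)
      = -(2 * particleExp θ p μ s (fun η => ∑ k, (η.1 k : ℝ) / N
          * walkAdjoint θ (fun a => (η.1 a : ℝ) / N) k)) := by
    have : (fun η : Config K N => (1 + θ) * ∑ k : ZMod K,
        ((η.1 (k + 1) : ℝ) / N - (η.1 k : ℝ) / N) ^ 2)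
        = fun η => (-2) * ∑ k, (η.1 k : ℝ) / N
          * walkAdjoint θ (fun a => (η.1 a : ℝ) / N) k := by
      funext η
      have := sum_mul_walkAdjoint θ (fun a => (η.1 a : ℝ) / N)
      linarith
    rw [this, particleExp, lawExp_const_mul, particleExp]
    ring
  have h2 := sum_mul_walkAdjoint θ (meanDensity θ p μ s)
  rw [← h1, h2, particleExp, lawExp_const_mul, lawExp_sum, ← sub_eq_add_neg, ← mul_sub,
    ← Finset.sum_sub_distrib]
  congr 1
  refine Finset.sum_congr rfl fun k _ => ?_
  have hmean : particleExp θ p μ s (lin (Pi.single (k + 1) 1 - Pi.single k 1))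
      = meanDensity θ p μ s (k + 1) - meanDensity θ p μ s k := by
    simp [particleExp_lin, sub_mul, Finset.sum_sub_distrib, Pi.single_apply]
  rw [lawVar, hmean]
  simp only [lin_sub, lin_single]
  rfl

theorem inv_card_le_sum_sq {v : ZMod K → ℝ} (hv : ∑ a, v a = 1) : 1 / (K : ℝ) ≤ ∑ a, v a ^ 2 := by
  have h := sum_sq_sub_inv_card hv
  have h2 : 0 ≤ ∑ a, (v a - 1 / (K : ℝ)) ^ 2 := Finset.sum_nonneg fun a _ => sq_nonneg _
  linarith

/-- The total variance of the empirical distribution is of order `1 / N` uniformly in time. -/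
theorem sum_lawVar_le (hK : 3 ≤ K) (hN : 2 ≤ N) (hθ : 0 < θ) (hp : 0 < p) (η : Config K N) {t : ℝ}
    (ht : 0 ≤ t) :
    ∑ k, lawVar θ p (Pi.single η 1) t (Pi.single k 1)
      ≤ (2 * (1 + θ) / N + pN N p * (1 - 1 / K))
        * ((1 - Real.exp (-rho K θ * t)) / rho K θ) := by
  have hN0 : N ≠ 0 := by omega
  have hρ := rho_pos hK hθ
  have hpN := pN_pos hN hp
  have hK' : (3 : ℝ) ≤ K := by exact_mod_cast hK
  have hKi : 1 / (K : ℝ) ≤ 1 := by rw [div_le_one (by linarith)]; linarith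
  set μ : Config K N → ℝ := Pi.single η 1 with hμdef
  have hμ : ∀ x, 0 ≤ μ x := fun x => by
    rw [hμdef, Pi.single_apply]; split_ifs <;> norm_num
  have hμ1 : ∑ x, μ x = 1 := by simp [hμdef]
  set c := 2 * (1 + θ) / N + pN N p * (1 - 1 / K) with hc
  have hc0 : 0 ≤ c := by
    have : 0 ≤ pN N p * (1 - 1 / K) := mul_nonneg hpN.le (by linarith)
    positivity
  -- The total variance satisfies V' ≤ c - 2 `rho` V; subtracting the equilibrium value c/(2 `rho`)
  -- makes this homogeneous.
  have hd := fun s => (HasDerivAt.fun_sum (u := Finset.univ)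
    fun k _ => hasDerivAt_lawVar_single (θ := θ) (p := p) (μ := μ) hN0 k s).sub_const
      (c / (2 * rho K θ))
  have h := le_exp_mul_of_deriv_le (c := 2 * rho K θ) hd (fun s hs => ?_) ht
  · have h0 : ∑ k, lawVar θ p μ 0 (Pi.single k 1) = 0 :=
      Finset.sum_eq_zero fun k _ => lawVar_single_init η _
    rw [h0] at h
    have hexp : Real.exp (-(2 * rho K θ) * t) = Real.exp (-rho K θ * t) ^ 2 := by
      rw [← Real.exp_nat_mul]
      congr 1
      push_cast
      ring
    rw [hexp] at h
    set e := Real.exp (-rho K θ * t)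
    -- The rate 2 `rho` is relaxed to `rho`: (1 - e²)/2 ≤ 1 - e, the gap being (1 - e)²/2.
    have h1 : c / (2 * rho K θ) * (1 - e) ^ 2 ≥ 0 := by positivity
    have h2 : c * ((1 - e) / rho K θ) = c / (2 * rho K θ) * (1 - e ^ 2)
        + c / (2 * rho K θ) * (1 - e) ^ 2 := by
      field_simp
      ring
    linarith
  · have hgap := rho_mul_sum_lawVar_le hN hθ hp hμ hμ1 hs
    rw [sum_lawVar_diff] at hgap
    have e1 : ∑ k, particleExp θ p μ s (fun η => (η.1 k : ℝ) / N
          * walkAdjoint θ (fun a => (η.1 a : ℝ) / N) k)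
        = particleExp θ p μ s (fun η => ∑ k, (η.1 k : ℝ) / N
          * walkAdjoint θ (fun a => (η.1 a : ℝ) / N) k) := by
      unfold particleExp
      rw [lawExp_sum]
    have e2 : ∑ k, particleExp θ p μ s (lin (carre θ (Pi.single k 1))) = 2 * (1 + θ) := by
      simp only [particleExp_lin]
      rw [Finset.sum_comm]
      simp only [← Finset.sum_mul, sum_carre_single hK, ← Finset.mul_sum,
        sum_meanDensity hN0 hμ1, mul_one]
    have e3 : 1 / (K : ℝ) ≤ ∑ k : ZMod K, particleExp θ p μ s (fun η => ((η.1 k : ℝ) / N) ^ 2) := by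
      unfold particleExp
      rw [← lawExp_sum, ← particleExp_const θ p μ hμ1 s (1 / (K : ℝ))]
      exact particleExp_mono hN hθ hp hμ hs fun η => inv_card_le_sum_sq (sum_density hN0 η)
    simp only [Finset.sum_add_distrib, Finset.sum_sub_distrib, ← Finset.mul_sum, e1, e2,
      sum_meanDensity hN0 hμ1]
    have e4 := mul_le_mul_of_nonneg_left e3 hpN.le
    have e5 : -(2 * rho K θ) * (∑ k, lawVar θ p μ s (Pi.single k 1) - c / (2 * rho K θ))
        = c - 2 * rho K θ * ∑ k, lawVar θ p μ s (Pi.single k 1) := by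
      field_simp
      ring
    rw [e5, hc]
    have e6 : 1 / (N : ℝ) * (2 * (1 + θ)) = 2 * (1 + θ) / N := by ring
    rw [e6]
    linarith

-- The factor K + 1 absorbs N/(N-1), and 1 - 1/K is at most its own square root.
omit [NeZero K] in
theorem constD_ge (hK : 3 ≤ K) (hN : 2 ≤ N) (hθ : 0 < θ) (hp : 0 < p) :
    2 * (1 + θ) / N + pN N p * (1 - 1 / (K : ℝ)) ≤ K / N * constD K θ p := by
  have hK' : (3 : ℝ) ≤ K := by exact_mod_cast hK
  have hN' : (2 : ℝ) ≤ N := by exact_mod_cast hN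
  have hN1 : (0 : ℝ) < N - 1 := by linarith
  have hK0 : (0 : ℝ) < K := by linarith
  have hs : √((K : ℝ) - 1) / √(K : ℝ) = √(1 - 1 / (K : ℝ)) := by
    rw [← Real.sqrt_div (by linarith), sub_div, div_self hK0.ne']
  have hsK : 0 < √(K : ℝ) := Real.sqrt_pos.mpr hK0
  have hi : 0 < 1 / (K : ℝ) := by positivity
  have hi1 : 1 / (K : ℝ) ≤ 1 := by rw [div_le_one hK0]; linarith
  have hle : 1 - 1 / (K : ℝ) ≤ √(1 - 1 / (K : ℝ)) := by
    apply Real.le_sqrt_of_sq_le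
    nlinarith
  set u := √(1 - 1 / (K : ℝ)) with hu
  have hu0 : 0 ≤ u := Real.sqrt_nonneg _
  have h1 : (K : ℝ) / N * constD K θ p = 2 * (1 + θ) * K / N + 2 * p * (K + 1) * u / N := by
    rw [constD, ← hs]
    field_simp
  have h2 : 2 * (1 + θ) / N ≤ 2 * (1 + θ) * K / N := by
    exact div_le_div_of_nonneg_right (le_mul_of_one_le_right (by linarith) (by linarith))
      (by linarith)
  have h3 : pN N p * (1 - 1 / (K : ℝ)) ≤ 2 * p * (K + 1) * u / N := by
    calc pN N p * (1 - 1 / (K : ℝ)) ≤ pN N p * u :=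
          mul_le_mul_of_nonneg_left hle (pN_pos hN hp).le
      _ = 2 * p * u / (N - 1) := by rw [pN]; ring
      _ ≤ 2 * p * (K + 1) * u / N := by
          rw [div_le_div_iff₀ hN1 (by linarith)]
          have : 0 ≤ 2 * p * u := by positivity
          have h4 : (N : ℝ) ≤ (K + 1) * (N - 1) := by nlinarith
          calc 2 * p * u * N ≤ 2 * p * u * ((K + 1) * (N - 1)) := by gcongr
            _ = _ := by ring
  linarith

end TotalVariance

/-! ### Expected Euclidean distance: bias and fluctuation. -/

section Distance

variable {K : ℕ} [NeZero K] {N : ℕ} {θ p : ℝ}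

theorem sqrt_sum_sq_add_le (f g : ZMod K → ℝ) :
    √(∑ k, (f k + g k) ^ 2) ≤ √(∑ k, f k ^ 2) + √(∑ k, g k ^ 2) := by
  have h := norm_add_le (WithLp.toLp 2 f : EuclideanSpace ℝ (ZMod K)) (WithLp.toLp 2 g)
  simpa [EuclideanSpace.norm_eq] using h

/-- The difference between the expected empirical distribution started from `η` and the law of
the walk with initial distribution `q`. -/
noncomputable def meanDiff (θ p : ℝ) (η : Config K N) (q : ZMod K → ℝ) (s : ℝ) (a : ZMod K) : ℝ :=
  meanDensity θ p (Pi.single η 1) s a - ∑ b, q b * walkTransition θ s b a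

theorem meanDiff_zero (η : Config K N) (q : ZMod K → ℝ) (a : ZMod K) :
    meanDiff θ p η q 0 a = (η.1 a : ℝ) / N - q a := by
  simp [meanDiff, meanDensity, particleExp, lawExp_zero, walkTransition, transition_zero,
    Matrix.one_apply, Pi.single_apply]

theorem hasDerivAt_meanDiff (η : Config K N) (q : ZMod K → ℝ) (a : ZMod K) (s : ℝ) :
    HasDerivAt (fun s => meanDiff θ p η q s a) (walkAdjoint θ (meanDiff θ p η q s) a) s := by
  refine ((hasDerivAt_meanDensity a s).sub (hasDerivAt_walkLaw θ q a s)).congr_deriv ?_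
  rw [← walkAdjoint_sub]
  rfl

theorem sqrt_exp_two_mul (c t x : ℝ) :
    √(Real.exp (-(2 * c) * t) * x) = Real.exp (-c * t) * √x := by
  rw [Real.sqrt_mul (Real.exp_pos _).le, show -(2 * c) * t = -c * t + -c * t by ring, Real.exp_add,
    Real.sqrt_mul_self (Real.exp_pos _).le]

theorem exp_alpha_le_particleExp_dist (hN : 2 ≤ N) (hθ : 0 < θ) (hp : 0 < p) (η : Config K N)
    (q : ZMod K → ℝ) {t : ℝ} (ht : 0 ≤ t) :
    Real.exp (-alpha K θ * t) * √(∑ a, ((η.1 a : ℝ) / N - q a) ^ 2)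
      ≤ particleExp θ p (Pi.single η 1) t
        (fun ξ => √(∑ a, ((ξ.1 a : ℝ) / N - ∑ b, q b * walkTransition θ t b a) ^ 2)) := by
  set μ : Config K N → ℝ := Pi.single η 1 with hμdef
  have hμ : ∀ x, 0 ≤ μ x := fun x => by
    rw [hμdef, Pi.single_apply]; split_ifs <;> norm_num
  have hμ1 : ∑ x, μ x = 1 := by simp [hμdef]
  have h1 := Real.sqrt_le_sqrt (exp_alpha_le_sum_sq hθ (hasDerivAt_meanDiff (p := p) η q) ht)
  simp only [meanDiff_zero] at h1
  rw [sqrt_exp_two_mul] at h1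
  refine h1.trans ?_
  set u := meanDiff θ p η q t with hu
  set F : Config K N → ℝ :=
    fun ξ => √(∑ a, ((ξ.1 a : ℝ) / N - ∑ b, q b * walkTransition θ t b a) ^ 2) with hF
  have hF0 : 0 ≤ particleExp θ p μ t F :=
    particleExp_nonneg hN hθ hp hμ ht fun ξ => Real.sqrt_nonneg _
  -- Since `u` is the mean of the random difference, pairing that difference with `u` and using
  -- Cauchy–Schwarz before averaging bounds the norm of the mean by the mean of the norm.
  have h2 : ∑ a, u a ^ 2 ≤ √(∑ a, u a ^ 2) * particleExp θ p μ t F := by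
    have e : ∑ a, u a ^ 2 = particleExp θ p μ t
        (fun ξ => ∑ a, u a * ((ξ.1 a : ℝ) / N - ∑ b, q b * walkTransition θ t b a)) := by
      rw [particleExp, lawExp_sum]
      refine Finset.sum_congr rfl fun a _ => ?_
      have hc := particleExp_const θ p μ hμ1 t (∑ b, q b * walkTransition θ t b a)
      rw [lawExp_const_mul, lawExp_sub, sq]
      unfold particleExp at hc
      rw [hc]
      rfl
    refine e.trans_le ?_
    conv_rhs => rw [particleExp, ← lawExp_const_mul]
    exact particleExp_mono hN hθ hp hμ ht fun ξ => Real.sum_mul_le_sqrt_mul_sqrt _ _ _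
  have hu0 : 0 ≤ ∑ a, u a ^ 2 := Finset.sum_nonneg fun a _ => sq_nonneg _
  rcases hu0.eq_or_lt with h0 | h0
  · rw [← h0, Real.sqrt_zero]
    exact hF0
  · have h3 : 0 < √(∑ a, u a ^ 2) := Real.sqrt_pos.mpr h0
    refine le_of_mul_le_mul_left ?_ h3
    rwa [Real.mul_self_sqrt hu0]

/-- Triangle inequality through the mean profile: the bias contracts at rate `rho`, and the
fluctuation is at most the root of the total variance. The D_K term alone covers that variance, so
any E ≥ 0 is admissible; both constants of the theorem are instances. -/
theorem particleExp_dist_le (hK : 3 ≤ K) (hN : 2 ≤ N) (hθ : 0 < θ) (hp : 0 < p) (η : Config K N)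
    {q : ZMod K → ℝ} (hq : ∑ a, q a = 1) {t : ℝ} (ht : 0 ≤ t) {E : ℝ} (hE : 0 ≤ E) :
    particleExp θ p (Pi.single η 1) t
        (fun ξ => √(∑ a, ((ξ.1 a : ℝ) / N - ∑ b, q b * walkTransition θ t b a) ^ 2))
      ≤ √((K : ℝ) / N) * (constD K θ p * ((1 - Real.exp (-rho K θ * t)) / rho K θ) + E)
          ^ ((1 : ℝ) / 2)
        + Real.exp (-rho K θ * t) * √(∑ a, ((η.1 a : ℝ) / N - q a) ^ 2) := by
  have hN0 : N ≠ 0 := by omega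
  have hρ := rho_pos hK hθ
  set μ : Config K N → ℝ := Pi.single η 1 with hμdef
  have hμ : ∀ x, 0 ≤ μ x := fun x => by
    rw [hμdef, Pi.single_apply]; split_ifs <;> norm_num
  have hμ1 : ∑ x, μ x = 1 := by simp [hμdef]
  have h1 := Real.sqrt_le_sqrt (sum_sq_le_exp_rho hθ (hasDerivAt_meanDiff (p := p) η q) (by
    simp only [meanDiff_zero, Finset.sum_sub_distrib]
    rw [sum_density hN0, hq, sub_self]) ht)
  simp only [meanDiff_zero] at h1
  rw [sqrt_exp_two_mul] at h1
  have hsplit : ∀ ξ : Config K N,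
      √(∑ a, ((ξ.1 a : ℝ) / N - ∑ b, q b * walkTransition θ t b a) ^ 2)
      ≤ √(∑ a, ((ξ.1 a : ℝ) / N - meanDensity θ p μ t a) ^ 2)
        + √(∑ a, meanDiff θ p η q t a ^ 2) := by
    intro ξ
    refine le_of_eq_of_le ?_ (sqrt_sum_sq_add_le _ _)
    congr 1
    refine Finset.sum_congr rfl fun a _ => ?_
    rw [meanDiff]
    ring
  refine (particleExp_mono hN hθ hp hμ ht hsplit).trans ?_
  rw [particleExp, lawExp_add]
  refine add_le_add ?_ ((le_of_eq (particleExp_const θ p μ hμ1 t _)).trans h1)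
  refine (particleExp_le_sqrt hN hθ hp hμ hμ1 ht _).trans ?_
  have h2 : (fun ξ : Config K N => √(∑ a, ((ξ.1 a : ℝ) / N - meanDensity θ p μ t a) ^ 2) ^ 2)
      = fun ξ => ∑ a, ((ξ.1 a : ℝ) / N - meanDensity θ p μ t a) ^ 2 := by
    funext ξ
    exact Real.sq_sqrt (Finset.sum_nonneg fun a _ => sq_nonneg _)
  have he : 0 ≤ (1 - Real.exp (-rho K θ * t)) / rho K θ := by
    apply div_nonneg _ hρ.le
    rw [sub_nonneg, Real.exp_le_one_iff]
    nlinarith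
  rw [h2, ← sum_lawVar_single hμ1, ← Real.sqrt_eq_rpow, ← Real.sqrt_mul (by positivity)]
  apply Real.sqrt_le_sqrt
  refine (sum_lawVar_le hK hN hθ hp η ht).trans ?_
  calc _ ≤ (K / N * constD K θ p) * ((1 - Real.exp (-rho K θ * t)) / rho K θ) :=
        mul_le_mul_of_nonneg_right (constD_ge hK hN hθ hp) he
    _ ≤ (K / N * constD K θ p) * ((1 - Real.exp (-rho K θ * t)) / rho K θ) + K / N * E :=
        le_add_of_nonneg_right (by positivity)
    _ = _ := by ring

end Distance

end FlemingViot

/-! ### From coordinates to measures and processes. -/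

namespace FlemingViot

section Translation

variable {K : ℕ} [NeZero K] {N : ℕ} {θ p : ℝ}

theorem empirical_real_singleton (η : Config K N) (k : ZMod K) :
    (empirical η).real {k} = (η.1 k : ℝ) / N := by
  have h : (empirical η) {k} = (N : ℝ≥0∞)⁻¹ * η.1 k := by
    simp [empirical, Measure.dirac_apply', Set.indicator_apply]
  rw [measureReal_def, h, ENNReal.toReal_mul, ENNReal.toReal_inv, ENNReal.toReal_natCast,
    ENNReal.toReal_natCast]
  ring

theorem dist₂_empirical (η : Config K N) (m : Measure (ZMod K)) :
    dist₂ (empirical η) m = √(∑ k, ((η.1 k : ℝ) / N - m.real {k}) ^ 2) := by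
  simp only [dist₂, empirical_real_singleton, sq_abs]

theorem sum_real_singleton {S : Type*} [Fintype S] [MeasurableSpace S] [MeasurableSingletonClass S]
    (m : Measure S) [IsProbabilityMeasure m] : ∑ x, m.real {x} = 1 := by
  rw [sum_measureReal_singleton, Finset.coe_univ, probReal_univ]

theorem dirac_real_singleton {S : Type*} [DecidableEq S] [MeasurableSpace S]
    [MeasurableSingletonClass S] (a : S) :
    (fun x => (Measure.dirac a).real {x}) = Pi.single a 1 := by
  funext x
  rw [measureReal_def, Measure.dirac_apply' _ (measurableSet_singleton x), Pi.single_apply]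
  by_cases h : x = a
  · simp [h]
  · simp [h, Ne.symm h]

/-- The law of the walk conditioned on not being killed is the law of the unkilled walk. -/
theorem cond_map_real {μ : Measure (ZMod K)} {Ω : Type*} [MeasurableSpace Ω] {P : Measure Ω}
    [IsProbabilityMeasure P] {Y : ℝ≥0 → Ω → ZMod K} {τ : Ω → ℝ} (hp : 0 < p)
    (hY : IsMarkovChain (rateMatrix (walkGenerator K θ)) μ P Y) (hτ : Measurable τ)
    (hlaw : P.map τ = expMeasure p) (hind : IndepFun τ (fun ω t => Y t ω) P) (t : ℝ≥0)
    (k : ZMod K) :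
    ((cond P {ω | (t : ℝ) ≤ τ ω}).map (Y t)).real {k}
      = ∑ a, μ.real {a} * walkTransition θ t a k := by
  have hset : MeasurableSet {ω | (t : ℝ) ≤ τ ω} := measurableSet_le measurable_const hτ
  have hindt : IndepFun τ (Y t) P := hind.comp measurable_id (measurable_pi_apply t)
  -- The event contains {t < τ}, whose probability e^{-pt} is read off the distribution function;
  -- positivity allows cancelling it after using independence.
  have hpos : P.real {ω | (t : ℝ) ≤ τ ω} ≠ 0 := by
    have := isProbabilityMeasure_expMeasure hp
    have h1 : P.real {ω | (t : ℝ) ≤ τ ω} = (expMeasure p).real (Set.Ici (t : ℝ)) := by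
      rw [← hlaw, map_measureReal_apply hτ measurableSet_Ici]
      rfl
    have h2 : (expMeasure p).real (Set.Ioi (t : ℝ)) = Real.exp (-(p * t)) := by
      rw [← Set.compl_Iic, probReal_compl_eq_one_sub measurableSet_Iic, ← cdf_eq_real,
        cdf_expMeasure_eq hp, if_pos t.coe_nonneg]
      ring
    have h3 : (expMeasure p).real (Set.Ioi (t : ℝ)) ≤ (expMeasure p).real (Set.Ici (t : ℝ)) :=
      measureReal_mono Set.Ioi_subset_Ici_self
    rw [h2] at h3
    rw [h1]
    exact ((Real.exp_pos _).trans_le h3).ne'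
  rw [map_measureReal_apply (hY.measurable t) (measurableSet_singleton k), measureReal_def,
    cond_apply hset, ENNReal.toReal_mul, ENNReal.toReal_inv, ← measureReal_def, ← measureReal_def]
  have hprod : P.real ({ω | (t : ℝ) ≤ τ ω} ∩ Y t ⁻¹' {k})
      = P.real {ω | (t : ℝ) ≤ τ ω} * P.real (Y t ⁻¹' {k}) := by
    have := hindt.measure_inter_preimage_eq_mul (Set.Ici (t : ℝ)) {k} measurableSet_Ici
      (measurableSet_singleton k)
    have h := congrArg ENNReal.toReal this
    rw [ENNReal.toReal_mul] at h
    exact h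
  rw [hprod, ← mul_assoc, inv_mul_cancel₀ hpos, one_mul,
    ← map_measureReal_apply (hY.measurable t) (measurableSet_singleton k), hY.map_real]
  rfl

end Translation

theorem constE_nonneg {K : ℕ} (hK : 3 ≤ K) {θ : ℝ} (hθ : 0 < θ) : 0 ≤ constE K θ := by
  have hK' : (3 : ℝ) ≤ K := by exact_mod_cast hK
  have h1 : (0 : ℝ) ≤ K - 1 := by linarith
  have h2 : (0 : ℝ) ≤ (K : ℝ) ^ 2 - 1 := by nlinarith
  unfold constE
  positivity

theorem constE'_nonneg {K : ℕ} (hK : 3 ≤ K) {θ p : ℝ} (hθ : 0 < θ) (hp : 0 < p) :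
    0 ≤ constE' K θ p := by
  have hK' : (3 : ℝ) ≤ K := by exact_mod_cast hK
  have h1 : (0 : ℝ) ≤ K - 1 := by linarith
  have h2 : (0 : ℝ) ≤ (K : ℝ) ^ 2 - 1 := by nlinarith
  unfold constE'
  positivity

end FlemingViot

open FlemingViot in
theorem theorem6 (K : ℕ) [NeZero K] (hK : 3 ≤ K) (θ p : ℝ) (hθ : 0 < θ) (hp : 0 < p) :
    -- uniform bound on the variance of the proportion of particles at each site
    (∀ N : ℕ, 2 ≤ N →
      ∀ ν : Measure (Config K N),
        IsStationary (rateMatrix (particleGenerator K N θ p)) ν →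
      -- the particle system started from `η`
      ∀ (η : Config K N) (Ω : Type*) [MeasurableSpace Ω] (P : Measure Ω) [IsProbabilityMeasure P]
        (X : ℝ≥0 → Ω → Config K N),
        IsMarkovChain (rateMatrix (particleGenerator K N θ p)) (Measure.dirac η) P X →
      -- the particle system started from `ν`
      ∀ (Ω' : Type*) [MeasurableSpace Ω'] (P' : Measure Ω') [IsProbabilityMeasure P']
        (X' : ℝ≥0 → Ω' → Config K N),
        IsMarkovChain (rateMatrix (particleGenerator K N θ p)) ν P' X' →
      ∀ (k : ZMod K) (t : ℝ≥0),
        |variance (fun ω => ((X t ω).1 k : ℝ) / N) P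
            - variance (fun ω => ((X' t ω).1 k : ℝ) / N) P'|
          ≤ constC K N θ p * expQuotient (pN N p) (rho K θ) t
            + Real.exp (-pN N p * t) * variance (fun ξ : Config K N => (ξ.1 0 : ℝ) / N) ν) ∧
    -- convergence to the conditioned process; the error `r` depends on `K`, `θ`, `p` only
    (∃ r : ℕ → ℝ, r =o[atTop] (fun N : ℕ => 1 / √(N : ℝ)) ∧
      ∀ N : ℕ, 2 ≤ N →
      ∀ (η : Config K N) (Ω : Type*) [MeasurableSpace Ω] (P : Measure Ω) [IsProbabilityMeasure P]
        (X : ℝ≥0 → Ω → Config K N),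
        IsMarkovChain (rateMatrix (particleGenerator K N θ p)) (Measure.dirac η) P X →
      -- the random walk `Y` with initial law `μ` and the independent killing time `τ`
      ∀ (μ : Measure (ZMod K)) [IsProbabilityMeasure μ]
        (Ω' : Type*) [MeasurableSpace Ω'] (P' : Measure Ω') [IsProbabilityMeasure P']
        (Y : ℝ≥0 → Ω' → ZMod K) (τ : Ω' → ℝ),
        IsMarkovChain (rateMatrix (walkGenerator K θ)) μ P' Y →
        Measurable τ → P'.map τ = expMeasure p →
        IndepFun τ (fun ω t => Y t ω) P' →
      ∀ t : ℝ≥0,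
        Real.exp (-alpha K θ * t) * dist₂ (empirical η) μ
          ≤ ∫ ω, dist₂ (empirical (X t ω)) ((cond P' {ω' | (t : ℝ) ≤ τ ω'}).map (Y t)) ∂P ∧
        ∫ ω, dist₂ (empirical (X t ω)) ((cond P' {ω' | (t : ℝ) ≤ τ ω'}).map (Y t)) ∂P
          ≤ √((K : ℝ) / N)
              * (constD K θ p * ((1 - Real.exp (-rho K θ * t)) / rho K θ)
                  + constE K θ) ^ ((1 : ℝ) / 2)
            + Real.exp (-rho K θ * t) * dist₂ (empirical η) μ + r N ∧
        ∫ ω, dist₂ (empirical (X t ω)) ((cond P' {ω' | (t : ℝ) ≤ τ ω'}).map (Y t)) ∂P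
          ≤ √((K : ℝ) / N)
              * (constD K θ p * ((1 - Real.exp (-rho K θ * t)) / rho K θ)
                  + constE' K θ p) ^ ((1 : ℝ) / 2)
            + Real.exp (-rho K θ * t) * dist₂ (empirical η) μ + r N) := by
  -- `sum_lawVar_le` bounds the variance directly for every `N`, so no error term is needed
  refine ⟨fun N hN ν hν η Ω _ P _ X hX Ω' _ P' _ X' hX' k t => ?_,
    fun _ => 0, isLittleO_zero _ _,
    fun N hN η Ω _ P _ X hX μ _ Ω' _ P' _ Y τ hY hτ hlaw hind t => ?_⟩
  · obtain ⟨hprob, hst⟩ := hν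
    have hvec : Matrix.vecMul (fun x => ν.real {x}) (rateMatrix (particleGenerator K N θ p)) = 0 :=
      funext hst
    have hvar : variance (fun ξ : Config K N => (ξ.1 0 : ℝ) / N) ν
        = lawVar θ p (fun x => ν.real {x}) 0 (Pi.single 0 1) := by
      rw [variance_eq_sub MemLp.of_discrete, integral_fintype Integrable.of_finite,
        integral_fintype Integrable.of_finite, lawVar, particleExp_of_stationary hvec,
        particleExp_of_stationary hvec]
      simp only [lin_single, smul_eq_mul, Pi.pow_apply]
    have h := abs_lawVar_sub_le hK hN hθ hp η (fun _ => measureReal_nonneg)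
      (sum_real_singleton ν) hvec k t.coe_nonneg
    rw [hX.variance_comp t (fun ξ => (ξ.1 k : ℝ) / N),
      hX'.variance_comp t (fun ξ => (ξ.1 k : ℝ) / N), hvar, dirac_real_singleton]
    simpa only [lawVar, particleExp, lin_single, funext (lin_single (N := N) k)] using h
  · simp only [dist₂_empirical, cond_map_real hp hY hτ hlaw hind]
    rw [hX.integral_comp t (fun ξ => √(∑ a, ((ξ.1 a : ℝ) / N
      - ∑ b, μ.real {b} * walkTransition θ t b a) ^ 2)), dirac_real_singleton, add_zero, add_zero]
    exact ⟨exp_alpha_le_particleExp_dist hN hθ hp η _ t.coe_nonneg,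
      particleExp_dist_le hK hN hθ hp η (sum_real_singleton μ) t.coe_nonneg (constE_nonneg hK hθ),
      particleExp_dist_le hK hN hθ hp η (sum_real_singleton μ) t.coe_nonneg (constE'_nonneg hK hθ hp)⟩
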